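/- For $N\in\mathbb N$ and $d>0$ let $y=(y_e)_e\in\{0,1\}^{\binom N2}$ be the vector of edge indicators of the Erdős–Rényi graph $G(N,d/N)$ on $[N]$ (only $N\ge d$ matters). A function $f:\{0,1\}^{\binom N2}\to\mathbb R$ has degree $D$ if it is a linear combination of functions of the form $y\mapsto\prod_{e\in I}f_e(y_e)$ with $|I|\le D$ and $f_e:\{0,1\}\to\mathbb R$ arbitrary. Let $\omega$ be a random variable with values in some space $\Omega_N$ and let $\vec U=(U_1,\dots,U_N)$ be i.i.d. uniform on $[-1,1]$, with $y,\omega,\vec U$ independent. For a measurable $\mathcal A^\circ=\mathcal A^\circ_N:\{0,1\}^{\binom N2}\times\Omega_N\to\mathbb R^N$, let $\mathcal A(y,\omega,\vec U)\in\{-1,1\}^N$ be its randomized rounding, whose $i$-th coordinate is $1$ if $\mathcal A^\circ(y,\omega)_i\ge U_i$ and $-1$ otherwise, identified with the vertex set $\{i\in[N]:\mathcal A(y,\omega,\vec U)_i=1\}$. **Corollary 3.10.** For every $\iota>0$ there exists $d_*(\iota)$ such that for all $d\ge d_*(\iota)$ the following holds. Let $C$ be a constant and let $D=D_N=o(N)$.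 Suppose that, for every $N$ and every fixed $\omega$, each of the $N$ coordinates of $\mathcal A^\circ_N(\cdot,\omega)$ has degree $D_N$, and that $\mathbb E[\|\mathcal A^\circ_N(y,\omega)\|^2]\le CN$ for all sufficiently large $N$. Then $$\mathbb P\Big[\mathcal A(y,\omega,\vec U)\text{ is an independent set of the graph } y \text{ of size at least } \frac{(1+\iota)\log d}{d}\,N\Big]\longrightarrow 0\qquad(N\to\infty).$$ -/

import Mathlib

open MeasureTheory ProbabilityTheory Filter Topology Asymptotics

noncomputable section

namespace SparseIndep

/-- The space of degree `D` functions on `Γ^κ`: the real span of all functions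
`y ↦ ∏ i ∈ I, f i (y i)` with `|I| ≤ D` and arbitrary `f i : Γ → ℝ`. -/
def degreeFunctions (κ Γ : Type*) (D : ℕ) : Submodule ℝ ((κ → Γ) → ℝ) :=
  Submodule.span ℝ
    {F | ∃ (I : Finset κ) (f : κ → Γ → ℝ), I.card ≤ D ∧ F = fun y => ∏ i ∈ I, f i (y i)}

/-- The `N choose 2` unordered pairs of distinct vertices in `Fin N`. -/
abbrev VertexPair (N : ℕ) : Type := {e : Sym2 (Fin N) // ¬ e.IsDiag}

open Classical in
/-- The vector of edge indicators of a graph on `Fin N`, a point of `{0,1}^(N choose 2)`. -/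
def edgeVector {N : ℕ} (G : SimpleGraph (Fin N)) : VertexPair N → Bool :=
  fun e => decide ((e : Sym2 (Fin N)) ∈ G.edgeSet)

/-- The law of the sparse random graph `G(N, d/N)`; the parameter is projected to `[0,1]`,
which has an effect only if `d/N` is not a probability. -/
def sparseGraph (N : ℕ) (d : ℝ) : Measure (SimpleGraph (Fin N)) :=
  SimpleGraph.binomialRandom (Fin N) (Set.projIcc (0 : ℝ) 1 zero_le_one (d / N))

/-- The law of `N` independent uniform random variables on `[-1,1]`. -/
def uniformNoise (N : ℕ) : Measure (Fin N → ℝ) :=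
  Measure.pi fun _ => ProbabilityTheory.cond volume (Set.Icc (-1 : ℝ) 1)

/-- Rounding of a real number at the threshold `u`. -/
def round (u x : ℝ) : ℝ := if u ≤ x then 1 else -1

/-- Coordinatewise rounding of a vector. -/
def roundVector {N : ℕ} (U : Fin N → ℝ) (x : EuclideanSpace ℝ (Fin N)) :
    EuclideanSpace ℝ (Fin N) :=
  WithLp.toLp 2 fun i => round (U i) (x i)

/-- The set of vertices encoded by a `±1`-vector. -/
def vertexSet {N : ℕ} (σ : EuclideanSpace ℝ (Fin N)) : Set (Fin N) := {i | σ i = 1}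

end SparseIndep

end

/-!
Resample every edge independently with probability `ε = c₀ / (D + 1)`. This is a reversible step of
the law of the random graph, and by the Efron–Stein decomposition a function of degree `D` moves in
mean square by at most a small multiple of its second moment, so the rounded output changes in
expectation by at most a small multiple of `log d / d * N` vertices. If the success probability
stays above `π`, then a step starts and ends in a success and changes the output by little with
probability at least `π ^ 2 / 2`. Reversibility and Jensen's inequality give this along a whole
path of length `2 ^ m = O(D + 1)` with probability at least `(π ^ 2 / 2) ^ (2 ^ m)`, which is
`e ^ (-o(N))`.

Along such a path the sets move slowly while the graphs decorrelate. By a discrete intermediate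
value argument one finds an independent set of more than three times the size `log d / d * N`, or a
long chain of large independent sets with increments of order `ι * (log d / d * N)`, or a large
independent set that nearly returns to the union of a chain although the graph has decorrelated
from those that carry the chain. First moment bounds give each of these probability at most
`e ^ (-cN)`, a contradiction.
-/

noncomputable section

namespace SparseIndep

open scoped Matrix

section Chain

variable {V : Type*} {n : ℕ}

/-- The weight of a path of the chain with initial weights `μ` and transition matrix `R`. -/
def pathWeight (μ : V → ℝ) (R : Matrix V V ℝ) (x : Fin (n + 1) → V) : ℝ :=
  μ (x 0) * ∏ i : Fin n, R (x i.castSucc) (x i.succ)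

theorem pathWeight_nonneg {μ : V → ℝ} {R : Matrix V V ℝ} (hμ : 0 ≤ μ) (hR : ∀ a b, 0 ≤ R a b)
    (x : Fin (n + 1) → V) : 0 ≤ pathWeight μ R x :=
  mul_nonneg (hμ _) (Finset.prod_nonneg fun _ _ => hR _ _)

variable [Fintype V]

section Probability

open Classical in
/-- The total weight of the paths of length `n` with property `Q`. -/
def pathProb (μ : V → ℝ) (R : Matrix V V ℝ) (n : ℕ) (Q : (Fin (n + 1) → V) → Prop) : ℝ :=
  ∑ x with Q x, pathWeight μ R x

variable {μ : V → ℝ} {R : Matrix V V ℝ} {Q Q' : (Fin (n + 1) → V) → Prop}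
  (hμ : 0 ≤ μ) (hR : ∀ a b, 0 ≤ R a b)
include hμ hR

theorem pathProb_nonneg : 0 ≤ pathProb μ R n Q :=
  Finset.sum_nonneg fun x _ => pathWeight_nonneg hμ hR x

theorem pathProb_mono (h : ∀ x, Q x → Q' x) : pathProb μ R n Q ≤ pathProb μ R n Q' := by
  classical
  exact Finset.sum_le_sum_of_subset_of_nonneg (Finset.monotone_filter_right _ fun x _ => h x)
    fun x _ _ => pathWeight_nonneg hμ hR x

theorem pathProb_or_le :
    pathProb μ R n (fun x => Q x ∨ Q' x) ≤ pathProb μ R n Q + pathProb μ R n Q' := by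
  classical
  simp only [pathProb]
  rw [← Finset.sum_union_inter, ← Finset.filter_or]
  convert le_add_of_nonneg_right (Finset.sum_nonneg fun x _ => pathWeight_nonneg hμ hR x)

theorem pathProb_exists_le {ι : Type*} (s : Finset ι) (Q : ι → (Fin (n + 1) → V) → Prop) :
    pathProb μ R n (fun x => ∃ i ∈ s, Q i x) ≤ ∑ i ∈ s, pathProb μ R n (Q i) := by
  classical
  induction s using Finset.induction with
  | empty => simp [pathProb]
  | insert i s hi ih =>
    simp only [Finset.exists_mem_insert, Finset.sum_insert hi]
    exact (pathProb_or_le hμ hR).trans (by gcongr)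

end Probability

/-- The sum over all paths `x` of length `n` from a given point of the transition weight of `x`
times `∏ i, f i (x i)`. -/
def pathSum (R : Matrix V V ℝ) : ℕ → (ℕ → V → ℝ) → V → ℝ
  | 0, f => f 0
  | n + 1, f => f 0 * R *ᵥ pathSum R n fun i => f (i + 1)

theorem sum_pathWeight_mul_prod (R : Matrix V V ℝ) (μ : V → ℝ) (f : ℕ → V → ℝ) :
    ∑ x : Fin (n + 1) → V, pathWeight μ R x * ∏ i : Fin (n + 1), f i (x i)
      = μ ⬝ᵥ pathSum R n f := by
  induction n generalizing μ f with
  | zero =>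
    rw [← (Equiv.funUnique (Fin 1) V).symm.sum_comp]
    simp [pathSum, pathWeight, dotProduct, uniqueElim_const]
  | succ n ih =>
    rw [← (Fin.consEquiv fun _ : Fin (n + 2) => V).sum_comp, Fintype.sum_prod_type]
    refine Finset.sum_congr rfl fun a _ => ?_
    rw [pathSum, Pi.mul_apply, Matrix.mulVec, ← ih, Finset.mul_sum, Finset.mul_sum]
    refine Finset.sum_congr rfl fun y _ => ?_
    rw [Fin.prod_univ_succ (n := n + 1)]
    simp only [pathWeight, Fin.prod_univ_succ (n := n), Fin.consEquiv_apply, Fin.castSucc_zero,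
      Fin.cons_zero, Fin.cons_succ, Fin.val_zero, Fin.val_succ, Fin.castSucc_succ]
    ring

theorem indicator_one_nonneg {V : Type*} (A : ℕ → Set V) :
    0 ≤ fun i => (A i).indicator (1 : V → ℝ) :=
  fun i => Set.indicator_nonneg (s := A i) fun _ _ => zero_le_one

theorem indicator_one_le_one {V : Type*} (A : ℕ → Set V) :
    (fun i => (A i).indicator (1 : V → ℝ)) ≤ 1 :=
  fun i => Set.indicator_le_self' (s := A i) fun _ _ => zero_le_one

theorem pathProb_forall_mem_le_dotProduct_pathSum {μ : V → ℝ} {R : Matrix V V ℝ} (hμ : 0 ≤ μ)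
    (hR : ∀ a b, 0 ≤ R a b) (A : ℕ → Set V) :
    pathProb μ R n (fun x => ∀ i : Fin (n + 1), x i ∈ A i)
      ≤ μ ⬝ᵥ pathSum R n fun i => (A i).indicator 1 := by
  classical
  rw [← sum_pathWeight_mul_prod, pathProb, Finset.sum_filter]
  refine Finset.sum_le_sum fun x _ => ?_
  split_ifs with hx
  · simp [hx]
  · exact mul_nonneg (pathWeight_nonneg hμ hR x)
      (Finset.prod_nonneg fun i _ => indicator_one_nonneg A i (x i))

theorem mulVec_mono {R : Matrix V V ℝ} (hR : ∀ a b, 0 ≤ R a b) : Monotone (R *ᵥ ·) :=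
  fun _ _ h a => dotProduct_le_dotProduct_of_nonneg_left h (hR a)

theorem pathSum_nonneg {R : Matrix V V ℝ} (hR : ∀ a b, 0 ≤ R a b) {f : ℕ → V → ℝ} (hf : 0 ≤ f) :
    0 ≤ pathSum R n f := by
  induction n generalizing f with
  | zero => exact hf 0
  | succ n ih =>
    refine mul_nonneg (hf 0) ?_
    simpa using mulVec_mono hR (ih fun i => hf (i + 1))

section Stochastic

variable [DecidableEq V] {R : Matrix V V ℝ} (hR : R ∈ Matrix.rowStochastic ℝ V) {f : ℕ → V → ℝ}
  (hf0 : 0 ≤ f) (hf1 : f ≤ 1)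
include hR hf0 hf1

theorem pathSum_succ_le : pathSum R (n + 1) f ≤ R *ᵥ pathSum R n fun i => f (i + 1) :=
  fun a => mul_le_of_le_one_left
    (Matrix.nonneg_mulVec_of_mem_rowStochastic hR (pathSum_nonneg hR.1 fun i => hf0 (i + 1)) a)
    (hf1 0 a)

theorem pathSum_le_one : pathSum R n f ≤ 1 := by
  induction n generalizing f with
  | zero => exact hf1 0
  | succ n ih =>
    refine (pathSum_succ_le hR hf0 hf1).trans ?_
    rw [← Matrix.one_vecMul_of_mem_rowStochastic hR]
    exact mulVec_mono hR.1 (ih (fun i => hf0 (i + 1)) fun i => hf1 (i + 1))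

theorem pathSum_le_apply_zero : pathSum R n f ≤ f 0 := by
  cases n with
  | zero => exact le_rfl
  | succ n =>
    intro a
    refine mul_le_of_le_one_right (hf0 0 a) ?_
    have hle := mulVec_mono hR.1
      (pathSum_le_one (n := n) hR (fun i => hf0 (i + 1)) fun i => hf1 (i + 1)) a
    simp only [Matrix.one_vecMul_of_mem_rowStochastic hR] at hle
    exact hle

theorem pathSum_add_le (s : ℕ) :
    pathSum R (s + n) f ≤ (R ^ s) *ᵥ pathSum R n fun i => f (s + i) := by
  induction s generalizing f with
  | zero => simp
  | succ s ih =>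
    rw [Nat.add_right_comm, pow_succ', ← Matrix.mulVec_mulVec]
    refine (pathSum_succ_le hR hf0 hf1).trans (mulVec_mono hR.1 ?_)
    simpa only [Nat.add_right_comm] using ih (fun i => hf0 (i + 1)) fun i => hf1 (i + 1)

theorem pathSum_le_pow_mulVec {t : ℕ} (ht : t ≤ n) : pathSum R n f ≤ (R ^ t) *ᵥ f t := by
  obtain ⟨n, rfl⟩ := Nat.exists_eq_add_of_le ht
  exact (pathSum_add_le hR hf0 hf1 t).trans <| mulVec_mono (pow_mem hR t).1 <|
    pathSum_le_apply_zero hR (fun i => hf0 (t + i)) fun i => hf1 (t + i)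

theorem pathSum_le_mul_pow_mulVec {t : ℕ} (h0 : 0 < t) (ht : t ≤ n) :
    pathSum R n f ≤ f 0 * (R ^ t) *ᵥ f t := by
  obtain ⟨n, rfl⟩ := Nat.exists_eq_add_of_lt (h0.trans_le ht)
  obtain ⟨t, rfl⟩ := Nat.exists_eq_add_of_lt h0
  simp only [zero_add] at ht ⊢
  rw [pow_succ', ← Matrix.mulVec_mulVec]
  refine fun a => mul_le_mul_of_nonneg_left (mulVec_mono hR.1 ?_ a) (hf0 0 a)
  exact pathSum_le_pow_mulVec hR (fun i => hf0 (i + 1)) (fun i => hf1 (i + 1)) (by omega)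

theorem pathSum_le_pow_mulVec_mul {s t : ℕ} (hst : s < t) (ht : t ≤ n) :
    pathSum R n f ≤ (R ^ s) *ᵥ (f s * (R ^ (t - s)) *ᵥ f t) := by
  obtain ⟨n, rfl⟩ := Nat.exists_eq_add_of_le (hst.le.trans ht)
  refine (pathSum_add_le hR hf0 hf1 s).trans (mulVec_mono (pow_mem hR s).1 ?_)
  have h := pathSum_le_mul_pow_mulVec (n := n) hR (fun i => hf0 (s + i)) (fun i => hf1 (s + i))
    (Nat.sub_pos_of_lt hst) (by omega)
  simpa only [add_zero, Nat.add_sub_cancel' hst.le] using h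

end Stochastic

/-- Detailed balance of the transition matrix `R` with respect to the weights `μ`. -/
def IsReversible (μ : V → ℝ) (R : Matrix V V ℝ) : Prop := ∀ a b, μ a * R a b = μ b * R b a

section Reversible

variable {μ : V → ℝ} {R : Matrix V V ℝ}

theorem IsReversible.dotProduct_mul_mulVec (h : IsReversible μ R) (f g : V → ℝ) :
    μ ⬝ᵥ (f * R *ᵥ g) = μ ⬝ᵥ (R *ᵥ f * g) := by
  simp only [dotProduct, Pi.mul_apply, Matrix.mulVec, Finset.mul_sum, Finset.sum_mul]
  rw [Finset.sum_comm]
  refine Finset.sum_congr rfl fun a _ => Finset.sum_congr rfl fun b _ => ?_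
  linear_combination (f b * g a) * h b a

/-- The mean of `F x y` over one step `x → y` of the chain with initial weights `μ` and transition
matrix `R`. -/
def stepMean (μ : V → ℝ) (R : Matrix V V ℝ) (F : V → V → ℝ) : ℝ :=
  ∑ x, ∑ y, μ x * R x y * F x y

theorem stepMean_mul (μ : V → ℝ) (R : Matrix V V ℝ) (f g : V → ℝ) :
    stepMean μ R (fun x y => f x * g y) = μ ⬝ᵥ (f * R *ᵥ g) := by
  simp only [stepMean, dotProduct, Pi.mul_apply, Matrix.mulVec, Finset.mul_sum]
  exact Finset.sum_congr rfl fun x _ => Finset.sum_congr rfl fun y _ => by ring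

theorem stepMean_mono (hμ : 0 ≤ μ) (hR : ∀ a b, 0 ≤ R a b) {F F' : V → V → ℝ}
    (h : ∀ x y, F x y ≤ F' x y) : stepMean μ R F ≤ stepMean μ R F' :=
  Finset.sum_le_sum fun x _ => Finset.sum_le_sum fun y _ =>
    mul_le_mul_of_nonneg_left (h x y) (mul_nonneg (hμ x) (hR x y))

theorem stepMean_sum {ι : Type*} [Fintype ι] (μ : V → ℝ) (R : Matrix V V ℝ) (F : ι → V → V → ℝ) :
    stepMean μ R (fun x y => ∑ i, F i x y) = ∑ i, stepMean μ R (F i) := by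
  simp only [stepMean, Finset.mul_sum]
  rw [Finset.sum_comm (s := (Finset.univ : Finset ι))]
  exact Finset.sum_congr rfl fun x _ => Finset.sum_comm

variable [DecidableEq V]

theorem stepMean_const_add_mul (hμ : ∑ x, μ x = 1) (hR : R ∈ Matrix.rowStochastic ℝ V) (a b : ℝ)
    (F : V → V → ℝ) : stepMean μ R (fun x y => a + b * F x y) = a + b * stepMean μ R F := by
  simp only [stepMean, mul_add, Finset.sum_add_distrib, ← Finset.sum_mul, ← Finset.mul_sum,
    Matrix.sum_row_of_mem_rowStochastic hR, mul_one, hμ, one_mul, mul_left_comm _ b]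

theorem IsReversible.pow (h : IsReversible μ R) (n : ℕ) :
    IsReversible μ (R ^ n) := by
  induction n with
  | zero =>
    intro a b
    rcases eq_or_ne a b with rfl | hab
    · rfl
    · simp [hab, hab.symm]
  | succ n ih =>
    intro a b
    conv_rhs => rw [pow_succ']
    rw [pow_succ, Matrix.mul_apply, Matrix.mul_apply, Finset.mul_sum, Finset.mul_sum]
    refine Finset.sum_congr rfl fun c _ => ?_
    linear_combination R c b * ih a c + (R ^ n) c a * h c b

/-- Splitting a path in the middle, reversibility makes the two halves conditionally independent
and identically distributed, so Jensen's inequality applies to the doubling of its length. -/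
theorem IsReversible.pow_dotProduct_mulVec_one_le (h : IsReversible μ R)
    (hμ : μ ∈ stdSimplex ℝ V) (hR : ∀ a b, 0 ≤ R a b) (m : ℕ) :
    (μ ⬝ᵥ R *ᵥ 1) ^ 2 ^ m ≤ μ ⬝ᵥ (R ^ 2 ^ m) *ᵥ 1 := by
  have hnonneg (k : ℕ) : 0 ≤ (R ^ k) *ᵥ 1 := by
    induction k with
    | zero => simp
    | succ k ih => simpa [pow_succ', ← Matrix.mulVec_mulVec] using mulVec_mono hR ih
  have hone : 0 ≤ μ ⬝ᵥ R *ᵥ 1 := dotProduct_nonneg_of_nonneg hμ.1 (by simpa using hnonneg 1)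
  induction m with
  | zero => simp
  | succ m ih =>
    calc (μ ⬝ᵥ R *ᵥ 1) ^ 2 ^ (m + 1) = ((μ ⬝ᵥ R *ᵥ 1) ^ 2 ^ m) ^ 2 := by rw [← pow_mul, pow_succ]
      _ ≤ (μ ⬝ᵥ (R ^ 2 ^ m) *ᵥ 1) ^ 2 := by gcongr
      _ ≤ μ ⬝ᵥ ((R ^ 2 ^ m) *ᵥ 1 * (R ^ 2 ^ m) *ᵥ 1) := by
        simpa only [sq, dotProduct, Pi.mul_apply] using Real.pow_arith_mean_le_arith_mean_pow
          Finset.univ μ _ (fun a _ => hμ.1 a) hμ.2 (fun a _ => hnonneg (2 ^ m) a) 2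
      _ = μ ⬝ᵥ (R ^ 2 ^ (m + 1)) *ᵥ 1 := by
        rw [← (h.pow (2 ^ m)).dotProduct_mul_mulVec, one_mul, Matrix.mulVec_mulVec, ← pow_add,
          pow_succ, mul_two]

open Classical in
theorem dotProduct_pow_mulVec_one_eq_pathProb (μ : V → ℝ) (R : Matrix V V ℝ)
    (r : V → V → Prop) :
    μ ⬝ᵥ ((Matrix.of fun a b => if r a b then R a b else 0) ^ n) *ᵥ 1
      = pathProb μ R n fun x => ∀ i : Fin n, r (x i.castSucc) (x i.succ) := by
  have hpow (R : Matrix V V ℝ) : pathSum R n 1 = (R ^ n) *ᵥ 1 := by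
    induction n with
    | zero => simp [pathSum]
    | succ n ih => rw [pow_succ', ← Matrix.mulVec_mulVec, ← ih, pathSum]; exact one_mul _
  rw [← hpow, ← sum_pathWeight_mul_prod, pathProb, Finset.sum_filter]
  refine Finset.sum_congr rfl fun x _ => ?_
  split_ifs with h
  · simp [pathWeight, h]
  · push Not at h
    obtain ⟨i, hi⟩ := h
    rw [pathWeight, Finset.prod_eq_zero (Finset.mem_univ i) (if_neg hi)]
    simp

omit [DecidableEq V] in
open Classical in
theorem IsReversible.stepMean_pow_le_pathProb (h : IsReversible μ R) (hμ : μ ∈ stdSimplex ℝ V)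
    (hR : ∀ a b, 0 ≤ R a b) {r : V → V → Prop} (hr : Std.Symm r) (m : ℕ) :
    stepMean μ R (fun x y => if r x y then 1 else 0) ^ 2 ^ m
      ≤ pathProb μ R (2 ^ m) fun x => ∀ i : Fin (2 ^ m), r (x i.castSucc) (x i.succ) := by
  set R' : Matrix V V ℝ := Matrix.of fun a b => if r a b then R a b else 0
  have hmean : stepMean μ R (fun x y => if r x y then 1 else 0) = μ ⬝ᵥ R' *ᵥ 1 := by
    simp [stepMean, dotProduct, Matrix.mulVec, R', Finset.mul_sum]
  have hR' : IsReversible μ R' := fun a b => by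
    simp only [R', Matrix.of_apply, hr.iff a b]
    split_ifs <;> simp [h a b]
  rw [← dotProduct_pow_mulVec_one_eq_pathProb, hmean]
  refine hR'.pow_dotProduct_mulVec_one_le hμ (fun a b => ?_) m
  simp only [R', Matrix.of_apply]
  split_ifs <;> simp [hR]

theorem IsReversible.dotProduct_pow_mulVec (h : IsReversible μ R)
    (hR : R ∈ Matrix.rowStochastic ℝ V) (f : V → ℝ) (n : ℕ) :
    μ ⬝ᵥ (R ^ n) *ᵥ f = μ ⬝ᵥ f := by
  have := (h.pow n).dotProduct_mul_mulVec 1 f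
  rwa [Matrix.one_vecMul_of_mem_rowStochastic (pow_mem hR n), one_mul, one_mul] at this

theorem IsReversible.stepMean_sub_sq (h : IsReversible μ R)
    (hR : R ∈ Matrix.rowStochastic ℝ V) (f : V → ℝ) :
    stepMean μ R (fun x y => (f x - f y) ^ 2) = 2 * (μ ⬝ᵥ (f * f) - μ ⬝ᵥ (f * R *ᵥ f)) := by
  have hx : stepMean μ R (fun x _ => f x * f x) = μ ⬝ᵥ (f * f) := by
    simpa [Matrix.one_vecMul_of_mem_rowStochastic hR] using stepMean_mul μ R (f * f) 1
  have hy : stepMean μ R (fun _ y => f y * f y) = μ ⬝ᵥ (f * f) := by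
    simpa [pow_one] using
      (stepMean_mul μ R 1 (f * f)).trans (h.dotProduct_pow_mulVec hR (f * f) 1 ▸ by simp)
  have hxy := stepMean_mul μ R f f
  have hsplit : stepMean μ R (fun x y => (f x - f y) ^ 2) = stepMean μ R (fun x _ => f x * f x)
      + stepMean μ R (fun _ y => f y * f y) - 2 * stepMean μ R (fun x y => f x * f y) := by
    simp only [stepMean, Finset.mul_sum, ← Finset.sum_add_distrib, ← Finset.sum_sub_distrib]
    exact Finset.sum_congr rfl fun x _ => Finset.sum_congr rfl fun y _ => by ring
  rw [hsplit, hx, hy, hxy]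
  ring

section Times

variable (h : IsReversible μ R) (hμ : 0 ≤ μ) (hR : R ∈ Matrix.rowStochastic ℝ V) (A : ℕ → Set V)
include h hμ hR

theorem IsReversible.pathProb_forall_mem_le {t : ℕ} (ht : t ≤ n) :
    pathProb μ R n (fun x => ∀ i : Fin (n + 1), x i ∈ A i) ≤ μ ⬝ᵥ (A t).indicator 1 := by
  rw [← h.dotProduct_pow_mulVec hR _ t]
  exact (pathProb_forall_mem_le_dotProduct_pathSum hμ hR.1 A).trans <|
    dotProduct_le_dotProduct_of_nonneg_left (pathSum_le_pow_mulVec hR (indicator_one_nonneg A)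
      (indicator_one_le_one A) ht) hμ

theorem IsReversible.pathProb_forall_mem_le_of_lt {s t : ℕ} (hst : s < t) (ht : t ≤ n) :
    pathProb μ R n (fun x => ∀ i : Fin (n + 1), x i ∈ A i)
      ≤ μ ⬝ᵥ ((A s).indicator 1 * (R ^ (t - s)) *ᵥ (A t).indicator 1) := by
  rw [← h.dotProduct_pow_mulVec hR _ s]
  exact (pathProb_forall_mem_le_dotProduct_pathSum hμ hR.1 A).trans <|
    dotProduct_le_dotProduct_of_nonneg_left (pathSum_le_pow_mulVec_mul hR (indicator_one_nonneg A)
      (indicator_one_le_one A) hst ht) hμ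

end Times

end Reversible

end Chain

section Product

variable {κ Γ : Type*} [Fintype κ]

/-- Product weights on `κ → Γ` with the same marginal `q` at each coordinate. -/
def piWeight (q : Γ → ℝ) (y : κ → Γ) : ℝ := ∏ e, q (y e)

/-- The transition matrix on `κ → Γ` whose coordinates move independently, the coordinate `e`
according to `R e`. -/
def piKernel (R : κ → Matrix Γ Γ ℝ) : Matrix (κ → Γ) (κ → Γ) ℝ :=
  Matrix.of fun y z => ∏ e, R e (y e) (z e)

theorem isReversible_piKernel {q : Γ → ℝ} {R : κ → Matrix Γ Γ ℝ}
    (h : ∀ e, IsReversible q (R e)) : IsReversible (piWeight q) (piKernel R) := fun y z => by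
  simp only [piWeight, piKernel, Matrix.of_apply, ← Finset.prod_mul_distrib, fun e => h e (y e)]

theorem piKernel_one [DecidableEq Γ] [DecidableEq (κ → Γ)] :
    piKernel (fun _ : κ => (1 : Matrix Γ Γ ℝ)) = 1 := by
  ext y z
  simp only [piKernel, Matrix.of_apply, Matrix.one_apply, funext_iff]
  split_ifs with h
  · exact Finset.prod_eq_one fun e _ => if_pos (h e)
  · obtain ⟨e, he⟩ := not_forall.1 h
    exact Finset.prod_eq_zero (Finset.mem_univ e) (if_neg he)

variable [DecidableEq κ] [Fintype Γ]

theorem piWeight_mem_stdSimplex {q : Γ → ℝ} (hq : q ∈ stdSimplex ℝ Γ) :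
    piWeight q ∈ stdSimplex ℝ (κ → Γ) := by
  refine ⟨fun y => Finset.prod_nonneg fun e _ => hq.1 _, ?_⟩
  simp only [piWeight]
  rw [← Fintype.prod_sum fun (_ : κ) => q, hq.2, Finset.prod_const_one]

theorem piKernel_mulVec_prod (R : κ → Matrix Γ Γ ℝ) (g : κ → Γ → ℝ) :
    (piKernel R *ᵥ fun y => ∏ e, g e (y e)) = fun y => ∏ e, (R e *ᵥ g e) (y e) := by
  ext y
  simp only [Matrix.mulVec, dotProduct, piKernel, Matrix.of_apply, Fintype.prod_sum,
    ← Finset.prod_mul_distrib]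

theorem piKernel_mul (R R' : κ → Matrix Γ Γ ℝ) :
    piKernel R * piKernel R' = piKernel fun e => R e * R' e := by
  ext y z
  simp only [Matrix.mul_apply, piKernel, Matrix.of_apply, Fintype.prod_sum,
    ← Finset.prod_mul_distrib]

theorem piKernel_mem_rowStochastic [DecidableEq Γ] {R : κ → Matrix Γ Γ ℝ}
    (hR : ∀ e, R e ∈ Matrix.rowStochastic ℝ Γ) :
    piKernel R ∈ Matrix.rowStochastic ℝ (κ → Γ) := by
  refine ⟨fun y z => Finset.prod_nonneg fun e _ => (hR e).1 _ _, ?_⟩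
  have h := piKernel_mulVec_prod R fun _ => 1
  simp only [Matrix.one_vecMul_of_mem_rowStochastic (hR _), Pi.one_apply,
    Finset.prod_const_one] at h
  exact h

theorem pathProb_forall_piKernel (q : Γ → ℝ) (R : κ → Matrix Γ Γ ℝ) (n : ℕ)
    (Q : κ → (Fin (n + 1) → Γ) → Prop) :
    pathProb (piWeight q) (piKernel R) n (fun x => ∀ e, Q e fun i => x i e)
      = ∏ e, pathProb q (R e) n (Q e) := by
  classical
  simp only [pathProb, Finset.sum_filter]
  rw [Fintype.prod_sum, ← (Equiv.piComm fun (_ : Fin (n + 1)) (_ : κ) => Γ).sum_comp]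
  refine Finset.sum_congr rfl fun x _ => ?_
  have hw : pathWeight (piWeight q) (piKernel R) x = ∏ e, pathWeight q (R e) fun i => x i e := by
    simp only [pathWeight, piWeight, piKernel, Matrix.of_apply, Finset.prod_mul_distrib]
    rw [Finset.prod_comm]
  rw [Finset.prod_ite_zero]
  simp only [Finset.mem_univ, true_imp_iff]
  exact if_congr Iff.rfl hw rfl

end Product

section Resample

variable {Γ : Type*} [DecidableEq Γ]

/-- The transition matrix that replaces the state, with probability `ε`, by a sample of `q`. -/
def resample (q : Γ → ℝ) (ε : ℝ) : Matrix Γ Γ ℝ := (1 - ε) • 1 + ε • Matrix.of fun _ => q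

theorem isReversible_resample (q : Γ → ℝ) (ε : ℝ) : IsReversible q (resample q ε) := fun a b => by
  rcases eq_or_ne a b with rfl | hab
  · rfl
  · simp only [resample, Matrix.add_apply, Matrix.smul_apply, Matrix.one_apply_ne hab,
      Matrix.one_apply_ne hab.symm, Matrix.of_apply, smul_eq_mul]
    ring

variable [Fintype Γ] {q : Γ → ℝ} {ε : ℝ}

theorem resample_mulVec (q : Γ → ℝ) (ε : ℝ) (g : Γ → ℝ) :
    resample q ε *ᵥ g = (1 - ε) • g + (ε * (q ⬝ᵥ g)) • 1 := by
  rw [resample, Matrix.add_mulVec, Matrix.smul_mulVec, Matrix.smul_mulVec, Matrix.one_mulVec]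
  ext a
  simp [Matrix.mulVec]

theorem resample_mem_rowStochastic (hq : q ∈ stdSimplex ℝ Γ) (hε : ε ∈ Set.Icc (0 : ℝ) 1) :
    resample q ε ∈ Matrix.rowStochastic ℝ Γ := by
  refine ⟨fun a b => ?_, ?_⟩
  · have := mul_nonneg hε.1 (hq.1 b)
    have := sub_nonneg.2 hε.2
    simp only [resample, Matrix.add_apply, Matrix.smul_apply, Matrix.one_apply, Matrix.of_apply,
      smul_eq_mul]
    positivity
  · rw [resample_mulVec, dotProduct_one, hq.2, ← add_smul]
    simp

theorem resample_pow_mulVec (hq : ∑ a, q a = 1) (ε : ℝ) (m : ℕ) (g : Γ → ℝ) :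
    (resample q ε ^ m) *ᵥ g = (1 - ε) ^ m • g + ((1 - (1 - ε) ^ m) * (q ⬝ᵥ g)) • 1 := by
  induction m with
  | zero => simp
  | succ m ih =>
    rw [pow_succ', ← Matrix.mulVec_mulVec, ih, resample_mulVec, dotProduct_add, dotProduct_smul,
      dotProduct_smul, dotProduct_one, hq]
    ext a
    simp only [Pi.add_apply, Pi.smul_apply, Pi.one_apply, smul_eq_mul]
    ring

end Resample

section Avoid

variable {Γ : Type*} [Fintype Γ] {q : Γ → ℝ} {ε : ℝ} {n : ℕ} {T : Set ℕ}

theorem dotProduct_indicator_ne (hq : ∑ b, q b = 1) (a : Γ) :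
    q ⬝ᵥ {b | b ≠ a}.indicator 1 = 1 - q a := by
  classical
  have hind : {b | b ≠ a}.indicator (1 : Γ → ℝ) = 1 - Pi.single a 1 := by
    ext b
    by_cases h : b = a <;> simp [h]
  rw [hind, dotProduct_sub, dotProduct_one, hq, dotProduct_single_one]

variable [DecidableEq Γ] (hq : q ∈ stdSimplex ℝ Γ) (hε : ε ∈ Set.Icc (0 : ℝ) 1)
include hq hε

theorem pathProb_avoid_le_one (a : Γ) (T : Set ℕ) :
    pathProb q (resample q ε) n (fun x => ∀ i : Fin (n + 1), (i : ℕ) ∈ T → x i ≠ a) ≤ 1 := by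
  refine (pathProb_mono hq.1 (resample_mem_rowStochastic hq hε).1 fun x _ i =>
    Set.mem_univ _).trans <| ((isReversible_resample q ε).pathProb_forall_mem_le hq.1
    (resample_mem_rowStochastic hq hε) (fun _ => Set.univ) n.zero_le).trans ?_
  rw [Set.indicator_univ, dotProduct_one, hq.2]

theorem pathProb_avoid_le (a : Γ) {t : ℕ} (ht : t ∈ T) (htn : t ≤ n) :
    pathProb q (resample q ε) n (fun x => ∀ i : Fin (n + 1), (i : ℕ) ∈ T → x i ≠ a)
      ≤ Real.exp (-q a) := by
  refine ((isReversible_resample q ε).pathProb_forall_mem_le hq.1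
    (resample_mem_rowStochastic hq hε) (fun i => {b | i ∈ T → b ≠ a}) htn).trans ?_
  simp only [ht, true_imp_iff]
  rw [dotProduct_indicator_ne hq.2]
  exact Real.one_sub_le_exp_neg (q a)

theorem pathProb_avoid_le_of_far (a : Γ) {s t : ℕ} {η : ℝ} (hs : s ∈ T) (ht : t ∈ T) (hst : s < t)
    (htn : t ≤ n) (hη : (1 - ε) ^ (t - s) ≤ η) :
    pathProb q (resample q ε) n (fun x => ∀ i : Fin (n + 1), (i : ℕ) ∈ T → x i ≠ a)
      ≤ Real.exp (-q a - (1 - η) * q a) := by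
  refine ((isReversible_resample q ε).pathProb_forall_mem_le_of_lt hq.1
    (resample_mem_rowStochastic hq hε) (fun i => {b | i ∈ T → b ≠ a}) hst htn).trans ?_
  simp only [hs, ht, true_imp_iff]
  set g : Γ → ℝ := {b | b ≠ a}.indicator 1
  have hgg : g * g = g := by ext b; by_cases h : b = a <;> simp [g, h]
  have hqg : q ⬝ᵥ g = 1 - q a := dotProduct_indicator_ne hq.2 a
  have hqa : 0 ≤ q a := hq.1 a
  have hqa1 : q a ≤ 1 := hq.2 ▸ Finset.single_le_sum (fun b _ => hq.1 b) (Finset.mem_univ a)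
  calc q ⬝ᵥ (g * (resample q ε ^ (t - s)) *ᵥ g)
      = (1 - q a) * (1 - (1 - (1 - ε) ^ (t - s)) * q a) := by
        rw [resample_pow_mulVec hq.2, mul_add, mul_smul_comm, mul_smul_comm, hgg, mul_one,
          dotProduct_add, dotProduct_smul, dotProduct_smul, hqg, smul_eq_mul, smul_eq_mul]
        ring
    _ ≤ (1 - q a) * (1 - (1 - η) * q a) := by gcongr
    _ ≤ Real.exp (-q a) * Real.exp (-((1 - η) * q a)) := by
        gcongr
        · nlinarith [(pow_nonneg (sub_nonneg.2 hε.2) (t - s)).trans hη]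
        · exact Real.one_sub_le_exp_neg _
        · exact Real.one_sub_le_exp_neg _
    _ = Real.exp (-q a - (1 - η) * q a) := by rw [← Real.exp_add, ← sub_eq_add_neg]

theorem pathProb_avoid_le_exp_ite (a : Γ) {η : ℝ} (hη : 0 ≤ η) {c c' : Prop} [Decidable c]
    [Decidable c'] (hc : c → ∃ s ∈ T, s ≤ n) (hc' : c' → ∃ t ∈ T, t ≤ n)
    (hfar : c → c' → ∃ s ∈ T, ∃ t ∈ T, s < t ∧ t ≤ n ∧ (1 - ε) ^ (t - s) ≤ η) :
    pathProb q (resample q ε) n (fun x => ∀ i : Fin (n + 1), (i : ℕ) ∈ T → x i ≠ a)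
      ≤ Real.exp (-(if c then q a else 0) - if c' then (1 - η) * q a else 0) := by
  have hqa : 0 ≤ q a := hq.1 a
  by_cases h : c <;> by_cases h' : c' <;> simp only [h, h', if_true, if_false]
  · obtain ⟨s, hs, t, ht, hst, htn, hpow⟩ := hfar h h'
    exact pathProb_avoid_le_of_far hq hε a hs ht hst htn hpow
  · obtain ⟨s, hs, hsn⟩ := hc h
    simpa using pathProb_avoid_le hq hε a hs hsn
  · obtain ⟨t, ht, htn⟩ := hc' h'
    refine (pathProb_avoid_le hq hε a ht htn).trans (Real.exp_le_exp.2 ?_)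
    nlinarith
  · simpa using pathProb_avoid_le_one hq hε a T

variable {κ : Type*} [Fintype κ] [DecidableEq κ]

theorem pathProb_piKernel_avoid_le (a : Γ) {η : ℝ} (hη : 0 ≤ η) {J : Type*} [Fintype J]
    (τ : J → Fin (n + 1)) (F : J → Finset κ) (t : Fin (n + 1)) (F' : Finset κ)
    (hfar : F'.Nonempty → ∀ j, τ j < t ∧ (1 - ε) ^ (t - τ j : ℕ) ≤ η) :
    pathProb (piWeight q) (piKernel fun _ : κ => resample q ε) n (fun x =>
        (∀ j, ∀ e ∈ F j, x (τ j) e ≠ a) ∧ ∀ e ∈ F', x t e ≠ a)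
      ≤ Real.exp (-(q a * (Finset.univ.biUnion F).card) - (1 - η) * q a * F'.card) := by
  set T : κ → Set ℕ := fun e => {i | (∃ j, (τ j : ℕ) = i ∧ e ∈ F j) ∨ (i = t ∧ e ∈ F')}
  have hsite (e : κ) : pathProb q (resample q ε) n
      (fun x => ∀ i : Fin (n + 1), (i : ℕ) ∈ T e → x i ≠ a)
      ≤ Real.exp (-(if e ∈ Finset.univ.biUnion F then q a else 0)
        - (if e ∈ F' then (1 - η) * q a else 0)) := by
    refine pathProb_avoid_le_exp_ite hq hε a hη (fun he => ?_)
      (fun he => ⟨t, Or.inr ⟨rfl, he⟩, t.is_le⟩) fun he he' => ?_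
    all_goals obtain ⟨j, -, hj⟩ := Finset.mem_biUnion.1 he
    · exact ⟨τ j, Or.inl ⟨j, rfl, hj⟩, (τ j).is_le⟩
    · obtain ⟨hlt, hpow⟩ := hfar ⟨e, he'⟩ j
      exact ⟨τ j, Or.inl ⟨j, rfl, hj⟩, t, Or.inr ⟨rfl, he'⟩, hlt, t.is_le, hpow⟩
  calc _ ≤ pathProb (piWeight q) (piKernel fun _ : κ => resample q ε) n
        (fun x => ∀ e, ∀ i : Fin (n + 1), (i : ℕ) ∈ T e → x i e ≠ a) := by
        refine pathProb_mono (piWeight_mem_stdSimplex hq).1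
          (piKernel_mem_rowStochastic fun _ => resample_mem_rowStochastic hq hε).1 ?_
        rintro x ⟨hx, hx'⟩ e i (⟨j, hj, he⟩ | ⟨hi, he⟩)
        · exact Fin.ext hj ▸ hx j e he
        · exact Fin.ext hi ▸ hx' e he
    _ ≤ ∏ e : κ, Real.exp (-(if e ∈ Finset.univ.biUnion F then q a else 0)
        - (if e ∈ F' then (1 - η) * q a else 0)) := by
        rw [pathProb_forall_piKernel _ _ _ fun e x => ∀ i : Fin (n + 1), (i : ℕ) ∈ T e → x i ≠ a]
        exact Finset.prod_le_prod (fun e _ => pathProb_nonneg hq.1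
          (resample_mem_rowStochastic hq hε).1) fun e _ => hsite e
    _ = _ := by
        rw [← Real.exp_sum, Finset.sum_sub_distrib, Finset.sum_neg_distrib, Finset.sum_ite_mem,
          Finset.sum_ite_mem, Finset.sum_const, Finset.sum_const]
        simp [mul_comm]

end Avoid

section EfronStein

variable {κ Γ : Type*} [Fintype κ] [DecidableEq κ] [DecidableEq Γ]

/-- The projection of functions on `κ → Γ` to the component of the Efron–Stein decomposition
indexed by `S`: coordinates in `S` are centred and the other ones averaged with respect to `q`. -/
def efronStein (q : Γ → ℝ) (S : Finset κ) : Matrix (κ → Γ) (κ → Γ) ℝ :=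
  piKernel fun e => if e ∈ S then 1 - resample q 1 else resample q 1

theorem isReversible_efronStein (q : Γ → ℝ) (S : Finset κ) :
    IsReversible (piWeight q) (efronStein q S) := by
  refine isReversible_piKernel fun e => ?_
  split_ifs
  · intro a b
    have hone : q a * (1 : Matrix Γ Γ ℝ) a b = q b * (1 : Matrix Γ Γ ℝ) b a := by
      rcases eq_or_ne a b with rfl | hab
      · rfl
      · simp [hab, hab.symm]
    rw [Matrix.sub_apply, Matrix.sub_apply, mul_sub, mul_sub, hone, isReversible_resample q 1 a b]
  · exact isReversible_resample q 1

theorem piKernel_resample_eq_sum (q : Γ → ℝ) (ε : ℝ) :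
    piKernel (fun _ : κ => resample q ε) = ∑ S : Finset κ, (1 - ε) ^ S.card • efronStein q S := by
  have hsite : resample q ε = (1 - ε) • (1 - resample q 1) + resample q 1 := by
    simp only [resample]
    module
  ext y z
  simp only [piKernel, Matrix.of_apply, efronStein, Matrix.sum_apply, Matrix.smul_apply]
  rw [hsite]
  simp only [Matrix.add_apply, Matrix.smul_apply, smul_eq_mul, Fintype.prod_add,
    Finset.prod_mul_distrib, Finset.prod_const, mul_assoc]
  refine Finset.sum_congr rfl fun S _ => congrArg _ ?_
  rw [← Finset.prod_mul_prod_compl S]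
  congr 1
  · exact Finset.prod_congr rfl fun e he => by rw [if_pos he]
  · exact Finset.prod_congr rfl fun e he => by rw [if_neg (Finset.mem_compl.1 he)]

variable [Fintype Γ] {q : Γ → ℝ}

theorem efronStein_mul_self (hq : ∑ a, q a = 1) (S : Finset κ) :
    efronStein q S * efronStein q S = efronStein q S := by
  have hidem : resample q 1 * resample q 1 = resample q 1 := by
    ext a b
    simp [resample, Matrix.mul_apply, ← Finset.sum_mul, hq]
  rw [efronStein, piKernel_mul]
  congr 1
  ext1 e
  split_ifs
  · rw [mul_sub, mul_one, sub_mul, one_mul, hidem, sub_self, sub_zero]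
  · exact hidem

theorem efronStein_empty_mulVec (q : Γ → ℝ) (f : (κ → Γ) → ℝ) :
    efronStein q ∅ *ᵥ f = fun _ => piWeight q ⬝ᵥ f := by
  ext y
  simp only [efronStein, piKernel, resample, Finset.notMem_empty, if_false, sub_self, zero_smul,
    zero_add, one_smul, Matrix.mulVec, Matrix.of_apply]
  rfl

theorem efronStein_mulVec_eq_zero (hq : ∑ a, q a = 1) {D : ℕ} {f : (κ → Γ) → ℝ}
    (hf : f ∈ degreeFunctions κ Γ D) {S : Finset κ} (hS : D < S.card) :
    efronStein q S *ᵥ f = 0 := by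
  induction hf using Submodule.span_induction with
  | zero => exact Matrix.mulVec_zero _
  | add f g _ _ hf hg => rw [Matrix.mulVec_add, hf, hg, add_zero]
  | smul c f _ hf => rw [Matrix.mulVec_smul, hf, smul_zero]
  | mem f hf =>
    obtain ⟨I, g, hI, rfl⟩ := hf
    obtain ⟨e, heS, heI⟩ := Finset.exists_mem_notMem_of_card_lt_card (hI.trans_lt hS)
    have hg : (fun y : κ → Γ => ∏ i ∈ I, g i (y i))
        = fun y => ∏ i, (if i ∈ I then g i else 1) (y i) := by
      ext y
      simp [Finset.prod_ite_mem, ite_apply]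
    rw [hg, efronStein, piKernel_mulVec_prod]
    refine funext fun y => Finset.prod_eq_zero (Finset.mem_univ e) ?_
    simp only [heS, heI, if_true, if_false]
    rw [Matrix.sub_mulVec, resample_mulVec]
    simp [dotProduct_one, hq]

theorem dotProduct_mul_efronStein_mulVec (hq : ∑ a, q a = 1) (S : Finset κ) (f : (κ → Γ) → ℝ) :
    piWeight q ⬝ᵥ (f * efronStein q S *ᵥ f)
      = piWeight q ⬝ᵥ (efronStein q S *ᵥ f * efronStein q S *ᵥ f) := by
  conv_lhs => rw [← efronStein_mul_self hq, ← Matrix.mulVec_mulVec,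
    (isReversible_efronStein q S).dotProduct_mul_mulVec]

theorem dotProduct_mul_efronStein_mulVec_nonneg (hq : q ∈ stdSimplex ℝ Γ) (S : Finset κ)
    (f : (κ → Γ) → ℝ) : 0 ≤ piWeight q ⬝ᵥ (f * efronStein q S *ᵥ f) := by
  rw [dotProduct_mul_efronStein_mulVec hq.2]
  exact dotProduct_nonneg_of_nonneg (piWeight_mem_stdSimplex hq).1 fun y => mul_self_nonneg _

theorem dotProduct_mul_piKernel_resample_mulVec (q : Γ → ℝ) (ε : ℝ) (f : (κ → Γ) → ℝ) :
    piWeight q ⬝ᵥ (f * piKernel (fun _ => resample q ε) *ᵥ f)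
      = ∑ S, (1 - ε) ^ S.card * (piWeight q ⬝ᵥ (f * efronStein q S *ᵥ f)) := by
  rw [piKernel_resample_eq_sum, Matrix.sum_mulVec, Finset.mul_sum, dotProduct_sum]
  simp only [Matrix.smul_mulVec, mul_smul_comm, dotProduct_smul, smul_eq_mul]

theorem sum_dotProduct_mul_efronStein_mulVec (q : Γ → ℝ) (f : (κ → Γ) → ℝ) :
    ∑ S, piWeight q ⬝ᵥ (f * efronStein q S *ᵥ f) = piWeight q ⬝ᵥ (f * f) := by
  have h := dotProduct_mul_piKernel_resample_mulVec q 0 f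
  have hone : resample q 0 = 1 := by simp [resample]
  simpa [hone, piKernel_one] using h.symm

variable {ε : ℝ} (hq : q ∈ stdSimplex ℝ Γ) (hε : ε ∈ Set.Icc (0 : ℝ) 1)
include hq hε

theorem sq_dotProduct_le_stepMean (f : (κ → Γ) → ℝ) :
    (piWeight q ⬝ᵥ f) ^ 2
      ≤ stepMean (piWeight q) (piKernel fun _ => resample q ε) fun y z => f y * f z := by
  have hempty : (piWeight q ⬝ᵥ f) ^ 2 = piWeight q ⬝ᵥ (f * efronStein q ∅ *ᵥ f) := by
    rw [dotProduct_mul_efronStein_mulVec hq.2, efronStein_empty_mulVec]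
    simp [dotProduct, ← Finset.sum_mul, (piWeight_mem_stdSimplex hq).2, sq]
  rw [stepMean_mul, dotProduct_mul_piKernel_resample_mulVec, hempty]
  refine le_trans ?_ (Finset.single_le_sum (fun S _ => mul_nonneg
    (pow_nonneg (sub_nonneg.2 hε.2) _) (dotProduct_mul_efronStein_mulVec_nonneg hq S f))
    (Finset.mem_univ ∅))
  simp

theorem stepMean_sub_sq_le {D : ℕ} {f : (κ → Γ) → ℝ} (hf : f ∈ degreeFunctions κ Γ D) :
    stepMean (piWeight q) (piKernel fun _ => resample q ε) (fun y z => (f y - f z) ^ 2)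
      ≤ 2 * D * ε * (piWeight q ⬝ᵥ (f * f)) := by
  rw [(isReversible_piKernel fun _ => isReversible_resample q ε).stepMean_sub_sq
    (piKernel_mem_rowStochastic fun _ => resample_mem_rowStochastic hq hε), mul_assoc, mul_assoc,
    dotProduct_mul_piKernel_resample_mulVec, ← sum_dotProduct_mul_efronStein_mulVec,
    ← Finset.sum_sub_distrib, ← mul_assoc (D : ℝ),
    Finset.mul_sum _ _ (D * ε : ℝ)]
  refine mul_le_mul_of_nonneg_left (Finset.sum_le_sum fun S _ => ?_) zero_le_two
  rcases lt_or_ge D S.card with hS | hS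
  · simp [efronStein_mulVec_eq_zero hq.2 hf hS]
  · rw [← one_sub_mul]
    refine mul_le_mul_of_nonneg_right ?_ (dotProduct_mul_efronStein_mulVec_nonneg hq S f)
    have hbernoulli := one_add_mul_le_pow (a := -ε) (by linarith [hε.2]) S.card
    have hcard : (S.card : ℝ) * ε ≤ D * ε := by have := hε.1; gcongr
    rw [← sub_eq_add_neg] at hbernoulli
    linarith

end EfronStein

section IncrementChain

variable {α : Type*} [DecidableEq α]

theorem biUnion_fin_succ {k : ℕ} (σ : Fin (k + 1) → Finset α) :
    Finset.univ.biUnion σ = σ 0 ∪ Finset.univ.biUnion (Fin.tail σ) := by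
  ext x
  simp [Fin.exists_fin_succ, Fin.tail]

/-- `σ k, …, σ 0` are sets of size at least `a`, the first one of size at most `M`, and each of the
others has between `β` and `2 * β` elements outside of the union of its predecessors. The newest set
has index `0`, so that a chain is extended by `Fin.cons`. -/
def IncrementChain (a M β : ℝ) : (k : ℕ) → (Fin (k + 1) → Finset α) → Prop
  | 0, σ => a ≤ (σ 0).card ∧ (σ 0).card ≤ M
  | k + 1, σ => IncrementChain a M β k (Fin.tail σ) ∧ a ≤ (σ 0).card ∧
      ((σ 0 \ Finset.univ.biUnion (Fin.tail σ)).card : ℝ) ∈ Set.Icc β (2 * β)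

theorem IncrementChain.card_biUnion_le {a M β : ℝ} {k : ℕ} {σ : Fin (k + 1) → Finset α}
    (h : IncrementChain a M β k σ) :
    ((Finset.univ.biUnion σ).card : ℝ) ≤ M + 2 * k * β := by
  induction k with
  | zero => simpa [biUnion_fin_succ] using h.2
  | succ k ih =>
    obtain ⟨hchain, -, -, hle⟩ := h
    rw [biUnion_fin_succ, ← Finset.sdiff_union_self_eq_union,
      Finset.card_union_of_disjoint Finset.sdiff_disjoint]
    push_cast
    linarith [ih hchain]

/-- A discrete intermediate value theorem: increments of size at most `β` cannot jump over the
window `[β, 2 * β]`. -/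
theorem exists_card_sdiff_mem_Icc {β : ℝ} (hβ : 0 < β) {A : ℕ → Finset α} {U : Finset α}
    {t₀ t₁ : ℕ} (ht : t₀ ≤ t₁) (h₀ : A t₀ ⊆ U) (h₁ : β ≤ (A t₁ \ U).card)
    (hstep : ∀ t < t₁, ((A (t + 1) \ A t).card : ℝ) ≤ β) :
    ∃ s ≤ t₁, ((A s \ U).card : ℝ) ∈ Set.Icc β (2 * β) := by
  induction t₁, ht using Nat.le_induction with
  | base =>
    rw [Finset.sdiff_eq_empty_iff_subset.2 h₀, Finset.card_empty, Nat.cast_zero] at h₁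
    exact absurd h₁ hβ.not_ge
  | succ t _ ih =>
    rcases le_or_gt β ((A t \ U).card : ℝ) with ht | ht
    · obtain ⟨s, hs, hsU⟩ := ih ht fun s hs => hstep s (hs.trans t.lt_succ_self)
      exact ⟨s, hs.trans t.le_succ, hsU⟩
    · refine ⟨t + 1, le_rfl, h₁, ?_⟩
      have hcard : ((A (t + 1) \ U).card : ℝ) ≤ (A (t + 1) \ A t).card + (A t \ U).card := by
        exact_mod_cast (Finset.card_le_card (sdiff_triangle _ _ _)).trans
          (Finset.card_union_le _ _)
      linarith [hstep t t.lt_succ_self]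

/-- Wait `W` steps after a chain is complete: either its union still nearly covers the current set,
or the chain can be extended. -/
theorem exists_return_or_incrementChain {a M β : ℝ} (hβ : 0 < β) {A : ℕ → Finset α} {T W : ℕ}
    (ha : ∀ t ≤ T, a ≤ (A t).card) (hM : ((A 0).card : ℝ) ≤ M)
    (hstep : ∀ t < T, ((A (t + 1) \ A t).card : ℝ) ≤ β) (k : ℕ) (hk : k * W ≤ T) :
    (∃ j < k, ∃ τ : Fin (j + 1) → ℕ, ∃ t ≤ T, IncrementChain a M β j (fun i => A (τ i)) ∧
      (∀ i, τ i + W ≤ t) ∧ ((A t \ Finset.univ.biUnion fun i => A (τ i)).card : ℝ) < β) ∨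
    ∃ τ : Fin (k + 1) → ℕ, IncrementChain a M β k (fun i => A (τ i)) ∧ ∀ i, τ i ≤ k * W := by
  induction k with
  | zero => exact Or.inr ⟨fun _ => 0, ⟨ha 0 T.zero_le, hM⟩, fun _ => Nat.zero_le _⟩
  | succ k ih =>
    rw [Nat.succ_mul] at hk ⊢
    rcases ih (by lia) with ⟨j, hj, h⟩ | ⟨τ, hτ, hτk⟩
    · exact Or.inl ⟨j, by lia, h⟩
    rcases lt_or_ge ((A (k * W + W) \ Finset.univ.biUnion fun i => A (τ i)).card : ℝ) β
      with hreturn | hfar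
    · exact Or.inl ⟨k, k.lt_succ_self, τ, _, hk, hτ, fun i => by grind, hreturn⟩
    obtain ⟨s, hs, hsU⟩ := exists_card_sdiff_mem_Icc hβ (by grind : τ 0 ≤ k * W + W)
      (Finset.subset_biUnion_of_mem (fun i => A (τ i)) (Finset.mem_univ 0)) hfar
      fun t ht => hstep t (by lia)
    refine Or.inr ⟨Fin.cons s τ, ⟨hτ, ha s (by lia), hsU⟩, fun i => ?_⟩
    cases i using Fin.cases with
    | zero => exact hs
    | succ i => grind [Fin.cons_succ]

end IncrementChain

section Inside

variable {V : Type*} [Fintype V] [DecidableEq V]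

/-- The pairs of distinct vertices with both ends in `S`. -/
def inside (S : Finset V) : Finset {e : Sym2 V // ¬ e.IsDiag} :=
  Finset.univ.filter fun e => ∀ v ∈ (e : Sym2 V), v ∈ S

theorem mem_inside {S : Finset V} {e : {e : Sym2 V // ¬ e.IsDiag}} :
    e ∈ inside S ↔ ∀ v ∈ (e : Sym2 V), v ∈ S := by simp [inside]

theorem inside_mono : Monotone (inside : Finset V → Finset {e : Sym2 V // ¬ e.IsDiag}) :=
  fun _ _ h _ he => mem_inside.2 fun v hv => h (mem_inside.1 he v hv)

theorem inside_inter (S S' : Finset V) : inside (S ∩ S') = inside S ∩ inside S' := by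
  ext e
  simp only [mem_inside, Finset.mem_inter, ← forall_and]

theorem card_inside (S : Finset V) : ((inside S).card : ℝ) = S.card * (S.card - 1) / 2 := by
  have hcard : (inside S).card = (S.offDiag.image Sym2.mk.uncurry).card := by
    refine Finset.card_bij (fun e _ => (e : Sym2 V)) ?_ (fun _ _ _ _ h => Subtype.ext h) ?_
    · rintro ⟨e, he⟩ hS
      induction e with
      | _ x y =>
        rw [mem_inside] at hS
        exact Finset.mem_image.2 ⟨(x, y), Finset.mem_offDiag.2
          ⟨hS x (Sym2.mem_mk_left _ _), hS y (Sym2.mem_mk_right _ _), he⟩, rfl⟩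
    · rintro e he
      obtain ⟨⟨x, y⟩, hxy, rfl⟩ := Finset.mem_image.1 he
      obtain ⟨hx, hy, hne⟩ := Finset.mem_offDiag.1 hxy
      refine ⟨⟨s(x, y), hne⟩, mem_inside.2 fun v hv => ?_, rfl⟩
      rcases Sym2.mem_iff.1 hv with rfl | rfl <;> assumption
  rw [hcard, Sym2.card_image_offDiag, Nat.cast_choose_two]

theorem card_inside_sdiff_inside (S U : Finset V) :
    ((inside S \ inside U).card : ℝ)
      = (S \ U).card * (S.card - ((S \ U).card + 1) / 2) := by
  have hpairs : ((inside S \ inside U).card : ℝ) + (inside (S ∩ U)).card = (inside S).card := by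
    rw [inside_inter]
    exact_mod_cast Finset.card_sdiff_add_card_inter _ _
  have hvertices : ((S \ U).card : ℝ) + (S ∩ U).card = S.card := by
    exact_mod_cast Finset.card_sdiff_add_card_inter _ _
  rw [card_inside, card_inside, eq_sub_of_add_eq' hvertices] at hpairs
  linear_combination hpairs

theorem card_biUnion_inside_ge {k : ℕ} (S : Finset V) (σ : Fin (k + 1) → Finset V) :
    ((Finset.univ.biUnion fun i => inside (σ i)).card : ℝ)
      + (inside S \ inside (Finset.univ.biUnion σ)).card
      ≤ (Finset.univ.biUnion fun i => inside ((Fin.cons S σ : Fin (k + 2) → Finset V) i)).card := by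
  set E := Finset.univ.biUnion fun i => inside (σ i)
  have hE : E ⊆ inside (Finset.univ.biUnion σ) := Finset.biUnion_subset.2 fun i _ =>
    inside_mono (Finset.subset_biUnion_of_mem _ (Finset.mem_univ i))
  have hcons : (Finset.univ.biUnion fun i => inside ((Fin.cons S σ : Fin (k + 2) → Finset V) i))
      = inside S ∪ E := biUnion_fin_succ _
  rw [hcons]
  norm_cast
  rw [← Finset.card_union_of_disjoint
    (Finset.disjoint_of_subset_left hE Finset.disjoint_sdiff), Finset.union_comm]
  exact Finset.card_le_card (Finset.union_subset_union Finset.sdiff_subset subset_rfl)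

end Inside

section Counting

variable {V : Type*} [Fintype V] [DecidableEq V]

theorem sum_exp_card_sdiff_le (ℓ : ℝ) (U : Finset V) :
    ∑ S : Finset V, Real.exp (-ℓ * (S \ U).card)
      ≤ Real.exp (U.card + Fintype.card V * Real.exp (-ℓ)) := by
  calc ∑ S : Finset V, Real.exp (-ℓ * (S \ U).card)
      = ∑ S : Finset V, ∏ v ∈ S, if v ∈ U then 1 else Real.exp (-ℓ) := by
        refine Finset.sum_congr rfl fun S _ => ?_
        rw [Finset.prod_ite, Finset.prod_const_one, one_mul, Finset.prod_const, mul_comm,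
          Real.exp_nat_mul, Finset.filter_notMem_eq_sdiff]
    _ = ∏ v : V, (1 + if v ∈ U then 1 else Real.exp (-ℓ)) := by
        rw [Finset.prod_one_add, Finset.powerset_univ]
    _ ≤ ∏ v : V, Real.exp ((if v ∈ U then 1 else 0) + Real.exp (-ℓ)) := by
        refine Finset.prod_le_prod (fun v _ => ?_) fun v _ => ?_
        · split_ifs <;> positivity
        · have hpos := Real.exp_pos (-ℓ)
          have hexp := Real.add_one_le_exp ((if v ∈ U then 1 else 0) + Real.exp (-ℓ))
          split_ifs at hexp ⊢ <;> linarith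
    _ = Real.exp (U.card + Fintype.card V * Real.exp (-ℓ)) := by
        rw [← Real.exp_sum, Finset.sum_add_distrib]
        simp

end Counting

/-- Parameters for the first moment bounds: `p` is the edge probability, `ℓ` stands for `log d` and
`Φ` for `N * log d / d`, which is half of the size of the largest independent sets, and `K` is the
length of the increment chains to be excluded. -/
structure Regime (N : ℕ) (p ℓ Φ ι : ℝ) (K : ℕ) : Prop where
  p_nonneg : 0 ≤ p
  p_le_one : p ≤ 1
  iota_pos : 0 < ι
  one_le_Phi : 1 ≤ Φ
  p_mul_Phi : p * Φ = ℓ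
  mul_exp_neg_le : N * Real.exp (-ℓ) ≤ Φ
  le_mul_sq_iota : 8 ≤ K * ι ^ 2
  ten_le : 10 ≤ ℓ
  one_le_iota_mul : 1 ≤ ι * ℓ
  le_sq_iota_mul : 16 * (4 + K * ι / 2 + ι / 8) ≤ ι ^ 2 * ℓ
  le_iota_mul : 8 * (7 + K * ι / 2 + ι) ≤ ι * ℓ

/-- Increment chains of sets of size at least `(1 + ι) * Φ` with increments of order `ι * Φ`. -/
abbrev LargeChain {α : Type*} [DecidableEq α] (Φ ι : ℝ) (k : ℕ) (σ : Fin (k + 1) → Finset α) :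
    Prop :=
  IncrementChain ((1 + ι) * Φ) (3 * Φ) (ι / 4 * Φ) k σ

open Classical in
/-- The expected number of large chains of independent sets, up to the identification of
`Real.exp (-p)` with `1 - p`. -/
def chainSum (N : ℕ) (p Φ ι : ℝ) (k : ℕ) : ℝ :=
  ∑ σ : Fin (k + 1) → Finset (Fin N) with LargeChain Φ ι k σ,
    Real.exp (-(p * (Finset.univ.biUnion fun i => inside (σ i)).card))

/-- The correlation allowed between the graphs at well separated times. -/
def decorrelation (ι : ℝ) : ℝ := ι / (1 + 2 * ι)

section Decorrelation

variable {ι : ℝ} (hι : 0 < ι)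
include hι

theorem decorrelation_pos : 0 < decorrelation ι := by
  unfold decorrelation
  positivity

theorem decorrelation_le_one : decorrelation ι ≤ 1 :=
  (div_le_one (by positivity)).2 (by linarith)

theorem one_add_half_le_one_sub_decorrelation_mul :
    1 + ι / 2 ≤ (1 - decorrelation ι) * (1 + 3 / 4 * ι) ^ 2 := by
  have hsub : 1 - decorrelation ι = (1 + ι) / (1 + 2 * ι) := by
    unfold decorrelation
    field_simp
    ring
  rw [hsub, div_mul_eq_mul_div, le_div_iff₀ (by positivity)]
  nlinarith [pow_pos hι 2, pow_pos hι 3]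

end Decorrelation

namespace Regime

variable {N : ℕ} {p ℓ Φ ι : ℝ} {K : ℕ} (h : Regime N p ℓ Φ ι K)
include h

theorem Phi_pos : 0 < Φ := one_pos.trans_le h.one_le_Phi

theorem Phi_mul_nonneg : 0 ≤ Φ * ℓ := by
  have := h.Phi_pos
  have := h.ten_le
  positivity

theorem p_mul_card_le (S : Finset (Fin N)) : p * S.card ≤ S.card :=
  mul_le_of_le_one_left (Nat.cast_nonneg _) h.p_le_one

theorem neg_mul_card_inside_le_of_large {S : Finset (Fin N)} (hS : 3 * Φ ≤ S.card) :
    -(p * (inside S).card) ≤ -(1 / 4) * (Φ * ℓ) - Φ + -ℓ * S.card := by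
  have hthree : 3 * ℓ ≤ p * S.card := by
    rw [← h.p_mul_Phi]
    linarith [mul_le_mul_of_nonneg_left hS h.p_nonneg]
  have hsq := mul_le_mul_of_nonneg_right hthree (Nat.cast_nonneg (α := ℝ) S.card)
  have hℓ := h.ten_le
  rw [card_inside]
  nlinarith [mul_le_mul_of_nonneg_right hS (by linarith : (0 : ℝ) ≤ ℓ - 1), h.p_mul_card_le S,
    h.Phi_pos]

theorem neg_mul_card_inside_le_of_small {S : Finset (Fin N)} (hS : S.card ≤ 3 * Φ) :
    -(p * (inside S).card) ≤ Φ * ℓ / 2 + 3 / 2 * Φ + -ℓ * S.card := by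
  have hsq := mul_nonneg h.p_nonneg (sq_nonneg (S.card - Φ))
  have hexpand : p * (S.card - Φ) ^ 2 = p * S.card ^ 2 - 2 * ℓ * S.card + Φ * ℓ := by
    rw [← h.p_mul_Phi]
    ring
  rw [card_inside]
  linarith [h.p_mul_card_le S]

theorem neg_mul_card_inside_sdiff_le {S U : Finset (Fin N)} (hS : (1 + ι) * Φ ≤ S.card)
    (hSU : ((S \ U).card : ℝ) ∈ Set.Icc (ι / 4 * Φ) (2 * (ι / 4 * Φ))) :
    -(p * (inside S \ inside U).card)
      ≤ -(ι / 4 * Φ * (3 / 4 * ι * ℓ - 1 / 2)) + -ℓ * (S \ U).card := by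
  have hslope : ℓ + (3 / 4 * ι * ℓ - 1 / 2) ≤ p * (S.card - ((S \ U).card + 1) / 2) := by
    have hlower := mul_le_mul_of_nonneg_left hS h.p_nonneg
    have hupper := mul_le_mul_of_nonneg_left hSU.2 h.p_nonneg
    have hlower' : p * ((1 + ι) * Φ) = (1 + ι) * ℓ := by rw [← h.p_mul_Phi]; ring
    have hupper' : p * (2 * (ι / 4 * Φ)) = ι / 2 * ℓ := by rw [← h.p_mul_Phi]; ring
    linarith [h.p_le_one]
  have hpairs := mul_le_mul_of_nonneg_left hslope (Nat.cast_nonneg (α := ℝ) (S \ U).card)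
  have hgain := mul_le_mul_of_nonneg_right hSU.1
    (by linarith [h.one_le_iota_mul] : 0 ≤ 3 / 4 * ι * ℓ - 1 / 2)
  rw [card_inside_sdiff_inside]
  linarith

theorem neg_mul_card_inside_le_of_return {S : Finset (Fin N)}
    (hS : (1 + 3 / 4 * ι) * Φ ≤ S.card) :
    -((1 - decorrelation ι) * p * (inside S).card)
      ≤ -(1 / 2 + ι / 4) * (Φ * ℓ) + (1 + 3 / 4 * ι) / 2 * Φ := by
  have hι := h.iota_pos
  have hγ : 0 ≤ 1 - decorrelation ι := sub_nonneg.2 (decorrelation_le_one hι)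
  set m : ℝ := (1 + 3 / 4 * ι) * Φ with hm
  have hm1 : 1 ≤ m := by nlinarith [h.one_le_Phi]
  have hpairs : m * (m - 1) ≤ S.card * (S.card - 1) := by nlinarith
  have hweighted := mul_le_mul_of_nonneg_left hpairs (mul_nonneg hγ h.p_nonneg)
  have hsq : (1 - decorrelation ι) * p * (m * m)
      = (1 - decorrelation ι) * (1 + 3 / 4 * ι) ^ 2 * (Φ * ℓ) := by
    rw [← h.p_mul_Phi, hm]
    ring
  have hlin : (1 - decorrelation ι) * p * m ≤ m := mul_le_of_le_one_left (by linarith)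
    (mul_le_one₀ (by linarith [decorrelation_pos hι]) h.p_nonneg h.p_le_one)
  have hgain := mul_le_mul_of_nonneg_right (one_add_half_le_one_sub_decorrelation_mul hι)
    h.Phi_mul_nonneg
  rw [card_inside]
  linarith

theorem sum_exp_card_le : ∑ S : Finset (Fin N), Real.exp (-ℓ * S.card) ≤ Real.exp Φ := by
  have hsum := sum_exp_card_sdiff_le ℓ (∅ : Finset (Fin N))
  simp only [Finset.sdiff_empty, Finset.card_empty, Nat.cast_zero, zero_add,
    Fintype.card_fin] at hsum
  exact hsum.trans (Real.exp_le_exp.2 h.mul_exp_neg_le)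

open Classical in
theorem sum_filter_exp_le {Q : Finset (Fin N) → Prop} {f : Finset (Fin N) → ℝ} {b : ℝ}
    (hf : ∀ S, Q S → f S ≤ b + -ℓ * S.card) :
    ∑ S : Finset (Fin N) with Q S, Real.exp (f S) ≤ Real.exp (b + Φ) := by
  calc ∑ S : Finset (Fin N) with Q S, Real.exp (f S)
      ≤ ∑ S : Finset (Fin N) with Q S, Real.exp (b + -ℓ * S.card) :=
        Finset.sum_le_sum fun S hS => Real.exp_le_exp.2 (hf S (Finset.mem_filter.1 hS).2)
    _ ≤ ∑ S : Finset (Fin N), Real.exp (b + -ℓ * S.card) :=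
        Finset.sum_le_univ_sum_of_nonneg fun S => Real.exp_nonneg _
    _ ≤ Real.exp (b + Φ) := by
        simp only [Real.exp_add, ← Finset.mul_sum]
        gcongr
        exact h.sum_exp_card_le

open Classical in
theorem sum_large_le :
    ∑ S : Finset (Fin N) with 3 * Φ ≤ S.card, Real.exp (-(p * (inside S).card))
      ≤ Real.exp (-(1 / 4) * (Φ * ℓ)) := by
  simpa using h.sum_filter_exp_le fun S => h.neg_mul_card_inside_le_of_large

theorem chainSum_zero_le : chainSum N p Φ ι 0 ≤ Real.exp (Φ * ℓ / 2 + 5 / 2 * Φ) := by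
  classical
  have hsum := h.sum_filter_exp_le (Q := fun S => LargeChain Φ ι 0 fun _ => S)
    fun S hS => h.neg_mul_card_inside_le_of_small hS.2
  rw [add_assoc, show 3 / 2 * Φ + Φ = 5 / 2 * Φ by ring] at hsum
  refine le_trans (le_of_eq ?_) hsum
  rw [chainSum, Finset.sum_filter, Finset.sum_filter,
    ← (Equiv.funUnique (Fin 1) (Finset (Fin N))).symm.sum_comp]
  refine Finset.sum_congr rfl fun S _ => ?_
  rw [show (Equiv.funUnique (Fin 1) (Finset (Fin N))).symm S = fun _ => S from
    funext fun _ => by simp [uniqueElim_const]]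
  simp [Finset.univ_unique]

theorem card_biUnion_le {k : ℕ} (hk : k ≤ K) {σ : Fin (k + 1) → Finset (Fin N)}
    (hσ : LargeChain Φ ι k σ) :
    ((Finset.univ.biUnion σ).card : ℝ) ≤ (3 + K * ι / 2) * Φ := by
  have hcard := hσ.card_biUnion_le
  have hkK : (k : ℝ) ≤ K := by exact_mod_cast hk
  linarith [mul_le_mul_of_nonneg_right hkK (mul_pos h.iota_pos h.Phi_pos).le]

open Classical in
theorem sum_increment_le {U : Finset (Fin N)} (hU : (U.card : ℝ) ≤ (3 + K * ι / 2) * Φ) :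
    ∑ S : Finset (Fin N) with (1 + ι) * Φ ≤ S.card ∧
        ((S \ U).card : ℝ) ∈ Set.Icc (ι / 4 * Φ) (2 * (ι / 4 * Φ)),
      Real.exp (-(p * (inside S \ inside U).card)) ≤ Real.exp (-(ι ^ 2 / 8) * (Φ * ℓ)) := by
  set b := -(ι / 4 * Φ * (3 / 4 * ι * ℓ - 1 / 2))
  calc _ ≤ ∑ S : Finset (Fin N), Real.exp (b + -ℓ * (S \ U).card) :=
        (Finset.sum_le_sum fun S hS => Real.exp_le_exp.2 <| by
          obtain ⟨-, hS, hSU⟩ := Finset.mem_filter.1 hS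
          exact h.neg_mul_card_inside_sdiff_le hS hSU).trans
        (Finset.sum_le_univ_sum_of_nonneg fun S => Real.exp_nonneg _)
    _ ≤ Real.exp (b + (U.card + N * Real.exp (-ℓ))) := by
        simp only [Real.exp_add b, ← Finset.mul_sum]
        gcongr
        simpa using sum_exp_card_sdiff_le ℓ U
    _ ≤ Real.exp (-(ι ^ 2 / 8) * (Φ * ℓ)) := by
        have hgain := mul_le_mul_of_nonneg_left h.le_sq_iota_mul h.Phi_pos.le
        rw [Real.exp_le_exp]
        simp only [b]
        linarith [h.mul_exp_neg_le]

theorem chainSum_succ_le {k : ℕ} (hk : k ≤ K) :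
    chainSum N p Φ ι (k + 1) ≤ chainSum N p Φ ι k * Real.exp (-(ι ^ 2 / 8) * (Φ * ℓ)) := by
  classical
  unfold chainSum
  rw [Finset.sum_filter, ← (Fin.consEquiv fun _ => Finset (Fin N)).sum_comp,
    Fintype.sum_prod_type_right, Finset.sum_filter, Finset.sum_mul]
  refine Finset.sum_le_sum fun σ _ => ?_
  split_ifs with hσ
  · refine le_trans ?_ (mul_le_mul_of_nonneg_left (h.sum_increment_le (h.card_biUnion_le hk hσ))
      (Real.exp_nonneg _))
    rw [← Finset.sum_filter, Finset.mul_sum]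
    refine (Finset.sum_congr (Finset.ext fun S => ?_) fun _ _ => rfl).trans_le
      (Finset.sum_le_sum fun S _ => ?_)
    · simp only [Finset.mem_filter]
      exact and_congr_right fun _ => and_iff_right hσ
    rw [← Real.exp_add, Real.exp_le_exp, ← neg_add, ← mul_add, neg_le_neg_iff]
    exact mul_le_mul_of_nonneg_left (card_biUnion_inside_ge S σ) h.p_nonneg
  · rw [zero_mul]
    exact (Finset.sum_eq_zero fun S _ => if_neg fun hS => hσ hS.1).le

theorem chainSum_le {k : ℕ} (hk : k ≤ K) :
    chainSum N p Φ ι k ≤ Real.exp (Φ * ℓ / 2 + 5 / 2 * Φ - k * (ι ^ 2 / 8 * (Φ * ℓ))) := by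
  induction k with
  | zero => simpa using h.chainSum_zero_le
  | succ k ih =>
    refine (h.chainSum_succ_le (Nat.le_of_succ_le hk)).trans ((mul_le_mul_of_nonneg_right
      (ih (Nat.le_of_succ_le hk)) (Real.exp_nonneg _)).trans_eq ?_)
    rw [← Real.exp_add]
    push_cast
    ring_nf

open Classical in
theorem sum_return_le {U : Finset (Fin N)} (hU : (U.card : ℝ) ≤ (3 + K * ι / 2) * Φ) :
    ∑ S ∈ U.powerset with (1 + 3 / 4 * ι) * Φ ≤ S.card,
        Real.exp (-((1 - decorrelation ι) * p * (inside S).card))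
      ≤ Real.exp (-(1 / 2 + ι / 8) * (Φ * ℓ) - 5 / 2 * Φ) := by
  set b := -(1 / 2 + ι / 4) * (Φ * ℓ) + (1 + 3 / 4 * ι) / 2 * Φ
  have hcard : (({S ∈ U.powerset | (1 + 3 / 4 * ι) * Φ ≤ S.card}.card : ℕ) : ℝ)
      ≤ Real.exp U.card := by
    calc _ ≤ ((2 ^ U.card : ℕ) : ℝ) := by
          rw [← Finset.card_powerset]
          exact_mod_cast Finset.card_filter_le _ _
      _ ≤ Real.exp 1 ^ U.card := by
          push_cast
          gcongr
          linarith [Real.add_one_le_exp (1 : ℝ)]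
      _ = Real.exp U.card := by rw [← Real.exp_nat_mul, mul_one]
  calc _ ≤ {S ∈ U.powerset | (1 + 3 / 4 * ι) * Φ ≤ S.card}.card • Real.exp b :=
        Finset.sum_le_card_nsmul _ _ _ fun S hS =>
          Real.exp_le_exp.2 (h.neg_mul_card_inside_le_of_return (Finset.mem_filter.1 hS).2)
    _ ≤ Real.exp U.card * Real.exp b := by
        rw [nsmul_eq_mul]
        gcongr
    _ ≤ Real.exp (-(1 / 2 + ι / 8) * (Φ * ℓ) - 5 / 2 * Φ) := by
        have hgain := mul_le_mul_of_nonneg_left h.le_iota_mul h.Phi_pos.le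
        rw [← Real.exp_add, Real.exp_le_exp]
        simp only [b]
        linarith [mul_pos h.iota_pos h.Phi_pos, h.Phi_pos]

end Regime

/-- The weights of a Bernoulli variable with parameter `p`. -/
def bernoulliWeight (p : ℝ) : Bool → ℝ := fun b => if b then p else 1 - p

theorem bernoulliWeight_mem_stdSimplex {p : ℝ} (hp : p ∈ Set.Icc (0 : ℝ) 1) :
    bernoulliWeight p ∈ stdSimplex ℝ Bool := by
  refine ⟨fun b => ?_, by simp [bernoulliWeight]⟩
  cases b
  · simpa [bernoulliWeight] using hp.2
  · simpa [bernoulliWeight] using hp.1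

/-- The weights of the edge vectors of the random graph with edge probability `p`. -/
abbrev graphWeight (N : ℕ) (p : ℝ) : (VertexPair N → Bool) → ℝ := piWeight (bernoulliWeight p)

/-- The transition matrix that resamples every edge independently with probability `ε`. -/
abbrev graphKernel (N : ℕ) (p ε : ℝ) : Matrix (VertexPair N → Bool) (VertexPair N → Bool) ℝ :=
  piKernel fun _ => resample (bernoulliWeight p) ε

/-- The set `S` is independent in the graph with edge vector `y`. -/
def EdgeFree {N : ℕ} (S : Finset (Fin N)) (y : VertexPair N → Bool) : Prop :=
  ∀ e ∈ inside S, y e ≠ true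

theorem EdgeFree.mono {N : ℕ} {S S' : Finset (Fin N)} {y : VertexPair N → Bool} (hS : S ⊆ S')
    (h : EdgeFree S' y) : EdgeFree S y :=
  fun e he => h e (inside_mono hS he)

section Paths

variable {N n : ℕ}

/-- The graphs at the times `τ` have independent sets that form a large chain. -/
def HasChain (Φ ι : ℝ) {k : ℕ} (τ : Fin (k + 1) → Fin (n + 1))
    (x : Fin (n + 1) → VertexPair N → Bool) : Prop :=
  ∃ σ : Fin (k + 1) → Finset (Fin N), LargeChain Φ ι k σ ∧ ∀ i, EdgeFree (σ i) (x (τ i))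

/-- The graphs at the times `τ` have independent sets that form a large chain, and the graph at
time `t` has a large independent set in the union of the chain. -/
def HasReturn (Φ ι : ℝ) {k : ℕ} (τ : Fin (k + 1) → Fin (n + 1)) (t : Fin (n + 1))
    (x : Fin (n + 1) → VertexPair N → Bool) : Prop :=
  ∃ σ : Fin (k + 1) → Finset (Fin N), LargeChain Φ ι k σ ∧ ∃ B ⊆ Finset.univ.biUnion σ,
    (1 + 3 / 4 * ι) * Φ ≤ B.card ∧ (∀ i, EdgeFree (σ i) (x (τ i))) ∧ EdgeFree B (x t)

namespace Regime

variable {p ℓ Φ ι ε : ℝ} {K : ℕ} (h : Regime N p ℓ Φ ι K) (hε : ε ∈ Set.Icc (0 : ℝ) 1)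
include h

theorem bernoulliWeight_mem : bernoulliWeight p ∈ stdSimplex ℝ Bool :=
  bernoulliWeight_mem_stdSimplex ⟨h.p_nonneg, h.p_le_one⟩

theorem graphWeight_nonneg : 0 ≤ graphWeight N p :=
  (piWeight_mem_stdSimplex h.bernoulliWeight_mem).1

include hε

theorem graphKernel_nonneg (y y' : VertexPair N → Bool) : 0 ≤ graphKernel N p ε y y' :=
  (piKernel_mem_rowStochastic fun _ => resample_mem_rowStochastic h.bernoulliWeight_mem hε).1 y y'

theorem pathProb_edgeFree_le {k : ℕ} (τ : Fin (k + 1) → Fin (n + 1))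
    (σ : Fin (k + 1) → Finset (Fin N)) :
    pathProb (graphWeight N p) (graphKernel N p ε) n (fun x => ∀ i, EdgeFree (σ i) (x (τ i)))
      ≤ Real.exp (-(p * (Finset.univ.biUnion fun i => inside (σ i)).card)) := by
  have havoid := pathProb_piKernel_avoid_le h.bernoulliWeight_mem hε true le_rfl τ
    (fun i => inside (σ i)) 0 ∅ fun hne => absurd hne Finset.not_nonempty_empty
  simpa [bernoulliWeight, EdgeFree] using havoid

theorem pathProb_edgeFree_and_le {W k : ℕ} (hW0 : 0 < W) (hW : (1 - ε) ^ W ≤ decorrelation ι)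
    {τ : Fin (k + 1) → Fin (n + 1)} {t : Fin (n + 1)} (hτ : ∀ i, (τ i : ℕ) + W ≤ t)
    (σ : Fin (k + 1) → Finset (Fin N)) (B : Finset (Fin N)) :
    pathProb (graphWeight N p) (graphKernel N p ε) n
        (fun x => (∀ i, EdgeFree (σ i) (x (τ i))) ∧ EdgeFree B (x t))
      ≤ Real.exp (-(p * (Finset.univ.biUnion fun i => inside (σ i)).card)) *
        Real.exp (-((1 - decorrelation ι) * p * (inside B).card)) := by
  rw [← Real.exp_add, ← sub_eq_add_neg]
  have hfar (i : Fin (k + 1)) : τ i < t ∧ (1 - ε) ^ (t - τ i : ℕ) ≤ decorrelation ι :=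
    ⟨Fin.lt_def.2 (by have := hτ i; lia), (pow_le_pow_of_le_one (sub_nonneg.2 hε.2)
      (by linarith [hε.1]) (by have := hτ i; lia)).trans hW⟩
  exact pathProb_piKernel_avoid_le h.bernoulliWeight_mem hε true (decorrelation_pos h.iota_pos).le τ
    (fun i => inside (σ i)) t (inside B) fun _ => hfar

theorem pathProb_exists_large_le :
    pathProb (graphWeight N p) (graphKernel N p ε) n
        (fun x => ∃ B : Finset (Fin N), 3 * Φ ≤ B.card ∧ EdgeFree B (x 0))
      ≤ Real.exp (-(1 / 4) * (Φ * ℓ)) := by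
  classical
  refine (pathProb_mono h.graphWeight_nonneg (h.graphKernel_nonneg hε) fun x hx => ?_).trans <|
    (pathProb_exists_le h.graphWeight_nonneg (h.graphKernel_nonneg hε)
      {B : Finset (Fin N) | 3 * Φ ≤ B.card} fun B x => EdgeFree B (x 0)).trans <|
    (Finset.sum_le_sum fun B _ => ?_).trans h.sum_large_le
  · simpa using hx
  · simpa using h.pathProb_edgeFree_le hε (fun _ : Fin (0 + 1) => (0 : Fin (n + 1))) fun _ => B

theorem pathProb_hasChain_le (τ : Fin (K + 1) → Fin (n + 1)) :
    pathProb (graphWeight N p) (graphKernel N p ε) n (HasChain Φ ι τ)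
      ≤ Real.exp (-(1 / 4) * (Φ * ℓ)) := by
  classical
  calc _ ≤ pathProb (graphWeight N p) (graphKernel N p ε) n fun x =>
          ∃ σ ∈ Finset.univ.filter (LargeChain Φ ι K), ∀ i, EdgeFree (σ i) (x (τ i)) :=
        pathProb_mono h.graphWeight_nonneg (h.graphKernel_nonneg hε) fun x hx => by
          simpa [HasChain] using hx
    _ ≤ chainSum N p Φ ι K :=
        (pathProb_exists_le h.graphWeight_nonneg (h.graphKernel_nonneg hε) _ _).trans
          (Finset.sum_le_sum fun σ _ => h.pathProb_edgeFree_le hε τ σ)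
    _ ≤ Real.exp (Φ * ℓ / 2 + 5 / 2 * Φ - K * (ι ^ 2 / 8 * (Φ * ℓ))) := h.chainSum_le le_rfl
    _ ≤ Real.exp (-(1 / 4) * (Φ * ℓ)) := by
        rw [Real.exp_le_exp]
        linarith [mul_le_mul_of_nonneg_right h.le_mul_sq_iota h.Phi_mul_nonneg,
          mul_le_mul_of_nonneg_left h.ten_le h.Phi_pos.le]

theorem pathProb_hasReturn_le {W k : ℕ} (hk : k ≤ K) (hW0 : 0 < W)
    (hW : (1 - ε) ^ W ≤ decorrelation ι) {τ : Fin (k + 1) → Fin (n + 1)} {t : Fin (n + 1)}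
    (hτ : ∀ i, (τ i : ℕ) + W ≤ t) :
    pathProb (graphWeight N p) (graphKernel N p ε) n (HasReturn Φ ι τ t)
      ≤ Real.exp (-(ι / 8) * (Φ * ℓ)) := by
  classical
  have hμ := h.graphWeight_nonneg
  have hR := h.graphKernel_nonneg hε
  calc _ ≤ pathProb (graphWeight N p) (graphKernel N p ε) n fun x =>
          ∃ σ ∈ Finset.univ.filter (LargeChain Φ ι k),
          ∃ B ∈ {B ∈ (Finset.univ.biUnion σ).powerset | (1 + 3 / 4 * ι) * Φ ≤ B.card},
            (∀ i, EdgeFree (σ i) (x (τ i))) ∧ EdgeFree B (x t) :=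
        pathProb_mono hμ hR fun x hx => by
          simpa [HasReturn, and_assoc] using hx
    _ ≤ ∑ σ with LargeChain Φ ι k σ,
          Real.exp (-(p * (Finset.univ.biUnion fun i => inside (σ i)).card)) *
            Real.exp (-(1 / 2 + ι / 8) * (Φ * ℓ) - 5 / 2 * Φ) := by
        refine (pathProb_exists_le hμ hR _ _).trans (Finset.sum_le_sum fun σ hσ => ?_)
        refine (pathProb_exists_le hμ hR _ _).trans (le_trans (Finset.sum_le_sum fun B _ =>
          h.pathProb_edgeFree_and_le hε hW0 hW hτ σ B) ?_)
        rw [← Finset.mul_sum]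
        gcongr
        exact h.sum_return_le (h.card_biUnion_le hk (Finset.mem_filter.1 hσ).2)
    _ = chainSum N p Φ ι k * Real.exp (-(1 / 2 + ι / 8) * (Φ * ℓ) - 5 / 2 * Φ) :=
        (Finset.sum_mul _ _ _).symm
    _ ≤ Real.exp (-(ι / 8) * (Φ * ℓ)) := by
        refine (mul_le_mul_of_nonneg_right (h.chainSum_le hk) (Real.exp_nonneg _)).trans ?_
        rw [← Real.exp_add, Real.exp_le_exp]
        have := mul_nonneg (Nat.cast_nonneg (α := ℝ) k)
          (mul_nonneg (by positivity : 0 ≤ ι ^ 2 / 8) h.Phi_mul_nonneg)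
        linarith

end Regime

/-- The output on `y` is an independent set of size at least `a`. -/
def Success (a : ℝ) (S : (VertexPair N → Bool) → Finset (Fin N)) (y : VertexPair N → Bool) : Prop :=
  EdgeFree (S y) y ∧ a ≤ (S y).card

/-- The outputs on both arguments are successes that differ in at most `β` elements. -/
def StableSuccess (a β : ℝ) (S : (VertexPair N → Bool) → Finset (Fin N))
    (y y' : VertexPair N → Bool) : Prop :=
  Success a S y ∧ Success a S y' ∧ ((symmDiff (S y) (S y')).card : ℝ) ≤ β

/-- The three exceptional events that together cover the paths of stable successes. -/
theorem exists_large_or_hasReturn_or_hasChain {Φ ι : ℝ} (hβ : 0 < ι / 4 * Φ) {K W : ℕ}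
    (hn0 : 0 < n) (hn : K * W ≤ n) {S : (VertexPair N → Bool) → Finset (Fin N)}
    {x : Fin (n + 1) → VertexPair N → Bool}
    (hx : ∀ i : Fin n,
      StableSuccess ((1 + ι) * Φ) (ι / 4 * Φ) S (x i.castSucc) (x i.succ)) :
    (∃ B : Finset (Fin N), 3 * Φ ≤ B.card ∧ EdgeFree B (x 0)) ∨
    (∃ k < K, ∃ τ : Fin (k + 1) → Fin (n + 1), ∃ t : Fin (n + 1), (∀ i, (τ i : ℕ) + W ≤ t) ∧
      HasReturn Φ ι τ t x) ∨
    ∃ τ : Fin (K + 1) → Fin (n + 1), HasChain Φ ι τ x := by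
  have hsuccess (t : Fin (n + 1)) : Success ((1 + ι) * Φ) S (x t) := by
    cases t using Fin.cases with
    | zero => exact (hx ⟨0, hn0⟩).1
    | succ i => exact (hx i).2.1
  rcases le_or_gt (3 * Φ) (S (x 0)).card with hlarge | hsmall
  · exact Or.inl ⟨S (x 0), hlarge, (hsuccess 0).1⟩
  right
  have hval {t : ℕ} (ht : t ≤ n) : (Fin.ofNat (n + 1) t : ℕ) = t := Nat.mod_eq_of_lt (by lia)
  set A : ℕ → Finset (Fin N) := fun t => S (x (Fin.ofNat (n + 1) t))
  have hstep (t : ℕ) (ht : t < n) : ((A (t + 1) \ A t).card : ℝ) ≤ ι / 4 * Φ := by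
    have hcast : Fin.ofNat (n + 1) t = Fin.castSucc ⟨t, ht⟩ := Fin.ext (hval ht.le)
    have hsucc : Fin.ofNat (n + 1) (t + 1) = Fin.succ ⟨t, ht⟩ := Fin.ext (hval ht)
    simp only [A, hcast, hsucc]
    refine le_trans ?_ (hx ⟨t, ht⟩).2.2
    exact_mod_cast Finset.card_le_card Finset.subset_union_right
  rcases exists_return_or_incrementChain (A := A) hβ (fun t _ => (hsuccess _).2) hsmall.le
    hstep K hn with ⟨k, hk, τ, t, ht, hchain, hfar, hreturn⟩ | ⟨τ, hchain, -⟩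
  · refine Or.inl ⟨k, hk, fun i => Fin.ofNat (n + 1) (τ i), Fin.ofNat (n + 1) t, fun i => ?_,
      fun i => A (τ i), hchain, A t ∩ Finset.univ.biUnion fun i => A (τ i),
      Finset.inter_subset_right, ?_, fun i => (hsuccess _).1,
      (hsuccess _).1.mono Finset.inter_subset_left⟩
    · have := hfar i
      rw [hval ht, hval (by lia)]
      exact this
    · have hsplit : ((A t \ Finset.univ.biUnion fun i => A (τ i)).card : ℝ)
          + (A t ∩ Finset.univ.biUnion fun i => A (τ i)).card = (A t).card := by
        exact_mod_cast Finset.card_sdiff_add_card_inter _ _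
      linarith [show (1 + ι) * Φ ≤ (A t).card from (hsuccess _).2]
  · exact Or.inr ⟨fun i => Fin.ofNat (n + 1) (τ i), fun i => A (τ i), hchain,
      fun i => (hsuccess _).1⟩

end Paths

section Stable

variable {N n : ℕ} {p ℓ Φ ι ε : ℝ} {K : ℕ}

namespace Regime

variable (h : Regime N p ℓ Φ ι K) (hε : ε ∈ Set.Icc (0 : ℝ) 1)
include h hε

theorem pathProb_exists_hasChain_le :
    pathProb (graphWeight N p) (graphKernel N p ε) n
        (fun x => ∃ τ : Fin (K + 1) → Fin (n + 1), HasChain Φ ι τ x)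
      ≤ ((n : ℝ) + 1) ^ (K + 1) * Real.exp (-(1 / 4) * (Φ * ℓ)) := by
  have hunion := pathProb_exists_le h.graphWeight_nonneg (h.graphKernel_nonneg hε) Finset.univ
    fun τ : Fin (K + 1) → Fin (n + 1) => HasChain (N := N) Φ ι τ
  refine le_trans (by simpa using hunion) ((Finset.sum_le_card_nsmul _ _ _ fun τ _ =>
    h.pathProb_hasChain_le hε τ).trans_eq ?_)
  simp

theorem pathProb_exists_hasReturn_le {W : ℕ} (hW0 : 0 < W) (hW : (1 - ε) ^ W ≤ decorrelation ι) :
    pathProb (graphWeight N p) (graphKernel N p ε) n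
        (fun x => ∃ k < K, ∃ τ : Fin (k + 1) → Fin (n + 1), ∃ t : Fin (n + 1),
          (∀ i, (τ i : ℕ) + W ≤ t) ∧ HasReturn Φ ι τ t x)
      ≤ K * ((n : ℝ) + 1) ^ (K + 1) * Real.exp (-(ι / 8) * (Φ * ℓ)) := by
  classical
  have hμ := h.graphWeight_nonneg
  have hR := h.graphKernel_nonneg hε
  have hfixed (k : ℕ) (hk : k < K) : pathProb (graphWeight N p) (graphKernel N p ε) n
      (fun x => ∃ τt ∈ {τt : (Fin (k + 1) → Fin (n + 1)) × Fin (n + 1) |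
        ∀ i, (τt.1 i : ℕ) + W ≤ τt.2}, HasReturn Φ ι τt.1 τt.2 x)
      ≤ ((n : ℝ) + 1) ^ (K + 1) * Real.exp (-(ι / 8) * (Φ * ℓ)) := by
    have hunion := pathProb_exists_le hμ hR {τt : (Fin (k + 1) → Fin (n + 1)) × Fin (n + 1) |
      ∀ i, (τt.1 i : ℕ) + W ≤ τt.2} fun τt => HasReturn (N := N) Φ ι τt.1 τt.2
    refine le_trans (by simpa using hunion) ((Finset.sum_le_card_nsmul _ _ _ fun τt hτt =>
      h.pathProb_hasReturn_le hε hk.le hW0 hW (Finset.mem_filter.1 hτt).2).trans ?_)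
    rw [nsmul_eq_mul]
    refine mul_le_mul_of_nonneg_right ?_ (Real.exp_nonneg _)
    calc _ ≤ (Fintype.card ((Fin (k + 1) → Fin (n + 1)) × Fin (n + 1)) : ℝ) := by
          exact_mod_cast Finset.card_le_univ _
      _ = ((n : ℝ) + 1) ^ (k + 2) := by
          rw [Fintype.card_prod, Fintype.card_fun, Fintype.card_fin, Fintype.card_fin]
          push_cast
          ring
      _ ≤ ((n : ℝ) + 1) ^ (K + 1) := pow_le_pow_right₀ (by simp) (by lia)
  refine (pathProb_mono hμ hR fun x hx => ?_).trans <|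
    (pathProb_exists_le hμ hR (Finset.range K) fun k x =>
      ∃ τt ∈ {τt : (Fin (k + 1) → Fin (n + 1)) × Fin (n + 1) |
        ∀ i, (τt.1 i : ℕ) + W ≤ τt.2}, HasReturn Φ ι τt.1 τt.2 x).trans <|
    (Finset.sum_le_card_nsmul _ _ _ fun k hk => hfixed k (Finset.mem_range.1 hk)).trans_eq ?_
  · obtain ⟨k, hk, τ, t, hτ, hret⟩ := hx
    exact ⟨k, Finset.mem_range.2 hk, (τ, t), by simpa using hτ, hret⟩
  · rw [Finset.card_range, nsmul_eq_mul, mul_assoc]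

theorem pathProb_stableSuccess_le {W : ℕ} (hn0 : 0 < n) (hW0 : 0 < W) (hn : K * W ≤ n)
    (hW : (1 - ε) ^ W ≤ decorrelation ι) (S : (VertexPair N → Bool) → Finset (Fin N)) :
    pathProb (graphWeight N p) (graphKernel N p ε) n (fun x => ∀ i : Fin n,
        StableSuccess ((1 + ι) * Φ) (ι / 4 * Φ) S (x i.castSucc) (x i.succ))
      ≤ (K + 2) * ((n : ℝ) + 1) ^ (K + 1) * Real.exp (-min (ι / 8) (1 / 4) * (Φ * ℓ)) := by
  have hμ := h.graphWeight_nonneg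
  have hR := h.graphKernel_nonneg hε
  have hpow : 1 ≤ ((n : ℝ) + 1) ^ (K + 1) := one_le_pow₀ (by simp)
  have hexp {s : ℝ} (hs : min (ι / 8) (1 / 4) ≤ s) :
      Real.exp (-s * (Φ * ℓ)) ≤ Real.exp (-min (ι / 8) (1 / 4) * (Φ * ℓ)) :=
    Real.exp_le_exp.2 (mul_le_mul_of_nonneg_right (neg_le_neg hs) h.Phi_mul_nonneg)
  calc _ ≤ _ := (pathProb_mono hμ hR fun x hx => exists_large_or_hasReturn_or_hasChain
          (mul_pos (by linarith [h.iota_pos]) h.Phi_pos) hn0 hn hx).trans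
        ((pathProb_or_le hμ hR).trans (add_le_add_right (pathProb_or_le hμ hR) _))
    _ ≤ 1 * Real.exp (-(1 / 4) * (Φ * ℓ))
          + (K * ((n : ℝ) + 1) ^ (K + 1) * Real.exp (-(ι / 8) * (Φ * ℓ))
            + ((n : ℝ) + 1) ^ (K + 1) * Real.exp (-(1 / 4) * (Φ * ℓ))) := by
        rw [one_mul]
        exact add_le_add (h.pathProb_exists_large_le hε)
          (add_le_add (h.pathProb_exists_hasReturn_le hε hW0 hW) (h.pathProb_exists_hasChain_le hε))
    _ ≤ ((n : ℝ) + 1) ^ (K + 1) * Real.exp (-min (ι / 8) (1 / 4) * (Φ * ℓ))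
          + (K * ((n : ℝ) + 1) ^ (K + 1) * Real.exp (-min (ι / 8) (1 / 4) * (Φ * ℓ))
            + ((n : ℝ) + 1) ^ (K + 1) * Real.exp (-min (ι / 8) (1 / 4) * (Φ * ℓ))) := by
        exact add_le_add
          (mul_le_mul hpow (hexp (min_le_right _ _)) (Real.exp_nonneg _) (by positivity))
          (add_le_add (mul_le_mul_of_nonneg_left (hexp (min_le_left _ _)) (by positivity))
            (mul_le_mul_of_nonneg_left (hexp (min_le_right _ _)) (by positivity)))
    _ = _ := by ring

end Regime

theorem symm_stableSuccess (a β : ℝ) (S : (VertexPair N → Bool) → Finset (Fin N)) :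
    Std.Symm (StableSuccess a β S) :=
  ⟨fun _ _ ⟨hy, hy', hd⟩ => ⟨hy', hy, symmDiff_comm (S _) (S _) ▸ hd⟩⟩

open Classical in
theorem indicator_success_mul_le {a β : ℝ} (hβ : 0 < β)
    (S : (VertexPair N → Bool) → Finset (Fin N)) (y y' : VertexPair N → Bool) :
    {y | Success a S y}.indicator (1 : (VertexPair N → Bool) → ℝ) y
        * {y | Success a S y}.indicator 1 y'
      ≤ (if StableSuccess a β S y y' then 1 else 0) + (symmDiff (S y) (S y')).card / β := by
  have hcard : 0 ≤ ((symmDiff (S y) (S y')).card : ℝ) / β := by positivity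
  by_cases hstable : ((symmDiff (S y) (S y')).card : ℝ) ≤ β
  · by_cases hy : Success a S y <;> by_cases hy' : Success a S y' <;>
      simp [StableSuccess, hy, hy', hstable, hcard]
  · have hfar : 1 ≤ ((symmDiff (S y) (S y')).card : ℝ) / β :=
      (one_le_div hβ).2 (not_le.1 hstable).le
    by_cases hy : Success a S y <;> by_cases hy' : Success a S y' <;>
      simp [StableSuccess, hy, hy', hstable, hcard, hfar]

theorem pow_le_pathProb_stableSuccess (hp : p ∈ Set.Icc (0 : ℝ) 1) (hε : ε ∈ Set.Icc (0 : ℝ) 1)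
    {a β π : ℝ} (hβ : 0 < β) (hπ : 0 ≤ π) {S : (VertexPair N → Bool) → Finset (Fin N)}
    (hsuccess : π ≤ graphWeight N p ⬝ᵥ {y | Success a S y}.indicator 1)
    (hstable : stepMean (graphWeight N p) (graphKernel N p ε)
      (fun y y' => ((symmDiff (S y) (S y')).card : ℝ)) ≤ π ^ 2 / 2 * β) (m : ℕ) :
    (π ^ 2 / 2) ^ 2 ^ m ≤ pathProb (graphWeight N p) (graphKernel N p ε) (2 ^ m) fun x =>
      ∀ i : Fin (2 ^ m), StableSuccess a β S (x i.castSucc) (x i.succ) := by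
  classical
  have hq := bernoulliWeight_mem_stdSimplex hp
  have hμ := piWeight_mem_stdSimplex (κ := VertexPair N) hq
  have hR := (piKernel_mem_rowStochastic (κ := VertexPair N)
    fun _ => resample_mem_rowStochastic hq hε).1
  have hpair : π ^ 2 ≤ stepMean (graphWeight N p) (graphKernel N p ε) (fun y y' =>
      (if StableSuccess a β S y y' then 1 else 0) + (symmDiff (S y) (S y')).card / β) := by
    refine (pow_le_pow_left₀ hπ hsuccess 2).trans
      ((sq_dotProduct_le_stepMean hq hε _).trans ?_)
    exact stepMean_mono hμ.1 hR fun y y' => indicator_success_mul_le hβ S y y'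
  have hsplit : stepMean (graphWeight N p) (graphKernel N p ε) (fun y y' =>
      (if StableSuccess a β S y y' then 1 else 0) + (symmDiff (S y) (S y')).card / β)
      = stepMean (graphWeight N p) (graphKernel N p ε)
          (fun y y' => if StableSuccess a β S y y' then 1 else 0)
        + stepMean (graphWeight N p) (graphKernel N p ε)
          (fun y y' => ((symmDiff (S y) (S y')).card : ℝ)) / β := by
    simp only [stepMean, mul_add, Finset.sum_add_distrib, Finset.sum_div, mul_div_assoc]
  have hfar := (div_le_iff₀ hβ).2 hstable
  refine (pow_le_pow_left₀ (by positivity) (by linarith) _).trans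
    ((isReversible_piKernel fun _ => isReversible_resample _ ε).stepMean_pow_le_pathProb hμ hR
      (symm_stableSuccess a β S) m)

end Stable

section Asymptotics

theorem eventually_mul_add_one_le {D : ℕ → ℕ}
    (hD : (fun N : ℕ => (D N : ℝ)) =o[atTop] (fun N : ℕ => (N : ℝ))) (B : ℝ) {s : ℝ} (hs : 0 < s) :
    ∀ᶠ N : ℕ in atTop, B * (D N + 1) ≤ s * N := by
  have hsucc : (fun N : ℕ => B * ((D N : ℝ) + 1)) =o[atTop] (fun N : ℕ => (N : ℝ)) :=
    (hD.add (isLittleO_const_left.2 <| Or.inr <|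
      tendsto_norm_atTop_atTop.comp tendsto_natCast_atTop_atTop)).const_mul_left B
  filter_upwards [hsucc.def hs] with N hN
  rw [Real.norm_of_nonneg (Nat.cast_nonneg N)] at hN
  exact (Real.le_norm_self _).trans hN

theorem eventually_mul_pow_lt_exp (A : ℝ) (k : ℕ) {b : ℝ} (hb : 0 < b) :
    ∀ᶠ N : ℕ in atTop, A * (N : ℝ) ^ k < Real.exp (b * N) := by
  have hpow := ((isLittleO_pow_exp_pos_mul_atTop (k := k) hb).const_mul_left A).def
    (one_half_pos (α := ℝ))
  filter_upwards [tendsto_natCast_atTop_atTop.eventually hpow] with N hN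
  rw [Real.norm_of_nonneg (Real.exp_nonneg _)] at hN
  linarith [Real.le_norm_self (A * (N : ℝ) ^ k), Real.exp_pos (b * N)]

theorem eventually_regime {ι : ℝ} (hι : 0 < ι) :
    ∃ dStar : ℝ, 1 < dStar ∧ ∀ d : ℝ, dStar ≤ d → ∀ᶠ N : ℕ in atTop,
      Regime N (d / N) (Real.log d) (Real.log d / d * N) ι ⌈8 / ι ^ 2⌉₊ := by
  set K := ⌈8 / ι ^ 2⌉₊
  suffices hlarge : ∀ d : ℝ, 1 < d → 10 ≤ Real.log d → 1 ≤ ι * Real.log d →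
      16 * (4 + K * ι / 2 + ι / 8) ≤ ι ^ 2 * Real.log d →
      8 * (7 + K * ι / 2 + ι) ≤ ι * Real.log d →
      ∀ᶠ N : ℕ in atTop, Regime N (d / N) (Real.log d) (Real.log d / d * N) ι K by
    have hlog (a : ℝ) {b : ℝ} (hb : 0 < b) : ∀ᶠ d : ℝ in atTop, a ≤ b * Real.log d :=
      (Real.tendsto_log_atTop.const_mul_atTop hb).eventually_ge_atTop a
    obtain ⟨dStar, hdStar⟩ := eventually_atTop.1 <| (eventually_gt_atTop 1).and <|
      (hlog 10 one_pos).and <| (hlog 1 hι).and <|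
      (hlog (16 * (4 + K * ι / 2 + ι / 8)) (sq_pos_of_pos hι)).and
      (hlog (8 * (7 + K * ι / 2 + ι)) hι)
    refine ⟨dStar, (hdStar dStar le_rfl).1, fun d hd => ?_⟩
    obtain ⟨hd1, h10, h1, h16, h8⟩ := hdStar d hd
    exact hlarge d hd1 (by linarith) h1 h16 h8
  intro d hd1 h10 h1 h16 h8
  have hd0 : 0 < d := one_pos.trans hd1
  have hlog0 : 0 < Real.log d := Real.log_pos hd1
  have hnat (a : ℝ) : ∀ᶠ N : ℕ in atTop, a ≤ N :=
    tendsto_natCast_atTop_atTop.eventually_ge_atTop a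
  filter_upwards [hnat d, hnat (d / Real.log d)] with N hdN hlogN
  have hN : (0 : ℝ) < N := hd0.trans_le hdN
  refine
    { p_nonneg := by positivity
      p_le_one := (div_le_one hN).2 hdN
      iota_pos := hι
      one_le_Phi := ?_
      p_mul_Phi := by field_simp
      mul_exp_neg_le := ?_
      le_mul_sq_iota := (div_le_iff₀ (by positivity)).1 (Nat.le_ceil (8 / ι ^ 2))
      ten_le := h10
      one_le_iota_mul := h1
      le_sq_iota_mul := h16
      le_iota_mul := h8 }
  · rw [div_mul_eq_mul_div, one_le_div hd0, mul_comm]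
    exact (div_le_iff₀ hlog0).1 hlogN
  · rw [Real.exp_neg, Real.exp_log hd0, div_mul_eq_mul_div, ← div_eq_mul_inv]
    gcongr
    exact le_mul_of_one_le_left hN.le (by linarith)

theorem exists_one_sub_pow_le {ε η : ℝ} (hε0 : 0 < ε) (hε1 : ε ≤ 1) (hη0 : 0 < η) (hη1 : η ≤ 1) :
    ∃ W : ℕ, 0 < W ∧ (1 - ε) ^ W ≤ η ∧ (W : ℝ) ≤ -Real.log η / ε + 2 := by
  have hlog : 0 ≤ -Real.log η := neg_nonneg.2 (Real.log_nonpos hη0.le hη1)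
  refine ⟨⌈-Real.log η / ε⌉₊ + 1, Nat.succ_pos _, ?_, ?_⟩
  · have hceil := (div_le_iff₀ hε0).1 (Nat.le_ceil (-Real.log η / ε))
    calc (1 - ε) ^ (⌈-Real.log η / ε⌉₊ + 1) ≤ (1 - ε) ^ ⌈-Real.log η / ε⌉₊ :=
          pow_le_pow_of_le_one (by linarith) (by linarith) (Nat.le_succ _)
      _ ≤ Real.exp (-ε) ^ ⌈-Real.log η / ε⌉₊ :=
          pow_le_pow_left₀ (by linarith) (Real.one_sub_le_exp_neg ε) _
      _ = Real.exp (⌈-Real.log η / ε⌉₊ * -ε) := (Real.exp_nat_mul _ _).symm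
      _ ≤ Real.exp (Real.log η) := Real.exp_le_exp.2 (by linarith)
      _ = η := Real.exp_log hη0
  · push_cast
    linarith [Nat.ceil_lt_add_one (div_nonneg hlog hε0.le)]

theorem exists_le_two_pow {n : ℕ} (hn : 0 < n) : ∃ m : ℕ, n ≤ 2 ^ m ∧ 2 ^ m ≤ 2 * n :=
  ⟨Nat.log 2 n + 1, (Nat.lt_pow_succ_log_self one_lt_two n).le, by
    rw [pow_succ']
    exact Nat.mul_le_mul_left 2 (Nat.pow_log_le_self 2 hn.ne')⟩

/-- At resampling rate `c₀ / (D + 1)` a path of length `2 ^ m = O(D + 1)` is long enough for `K`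
consecutive decorrelations. -/
theorem exists_path_length {ι c₀ : ℝ} (hι : 0 < ι) (hc₀ : 0 < c₀) (hc₁ : c₀ ≤ 1) {K : ℕ}
    (hK : 0 < K) : ∃ B : ℝ, ∀ D : ℕ, ∃ W m : ℕ, 0 < W ∧
      (1 - c₀ / (D + 1)) ^ W ≤ decorrelation ι ∧ K * W ≤ 2 ^ m ∧
      ((2 ^ m : ℕ) : ℝ) ≤ B * (D + 1) := by
  set η := decorrelation ι
  refine ⟨2 * K * (-Real.log η / c₀ + 2), fun D => ?_⟩
  have hD : (1 : ℝ) ≤ D + 1 := by simp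
  obtain ⟨W, hW0, hW, hWle⟩ := exists_one_sub_pow_le (ε := c₀ / (D + 1)) (by positivity)
    ((div_le_one (by positivity)).2 (hc₁.trans hD)) (decorrelation_pos hι)
    (decorrelation_le_one hι)
  obtain ⟨m, hm, hm2⟩ := exists_le_two_pow (Nat.mul_pos hK hW0)
  refine ⟨W, m, hW0, hW, hm, ?_⟩
  calc ((2 ^ m : ℕ) : ℝ) ≤ 2 * (K * W) := by exact_mod_cast hm2
    _ ≤ 2 * (K * (-Real.log η / (c₀ / (D + 1)) + 2 * (D + 1))) := by
        gcongr
        linarith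
    _ = 2 * K * (-Real.log η / c₀ + 2) * (D + 1) := by field_simp

theorem exp_neg_le_pow {x c : ℝ} (hx : 0 < x) {n : ℕ} (hc : |Real.log x| * n ≤ c) :
    Real.exp (-c) ≤ x ^ n := by
  rw [← Real.exp_log (pow_pos hx n), Real.log_pow, Real.exp_le_exp]
  have := mul_le_mul_of_nonneg_right (neg_abs_le (Real.log x)) n.cast_nonneg
  linarith

/-- Success along the path has probability at least `e ^ (-cN / 3)`, while the exceptional events
have probability at most `e ^ (cN / 3) * e ^ (-cN)`. -/
theorem eventually_lt_stepMean {ι : ℝ} (hι : 0 < ι) :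
    ∃ dStar : ℝ, 1 < dStar ∧ ∀ d : ℝ, dStar ≤ d → ∀ (D : ℕ → ℕ),
      (fun N : ℕ => (D N : ℝ)) =o[atTop] (fun N : ℕ => (N : ℝ)) →
      ∀ π : ℝ, 0 < π → ∀ c₀ : ℝ, 0 < c₀ → c₀ ≤ 1 → ∀ᶠ N : ℕ in atTop,
        ∀ S : (VertexPair N → Bool) → Finset (Fin N),
          π ≤ graphWeight N (d / N) ⬝ᵥ
            {y | Success ((1 + ι) * (Real.log d / d * N)) S y}.indicator 1 →
          π ^ 2 / 2 * (ι / 4 * (Real.log d / d * N)) <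
            stepMean (graphWeight N (d / N)) (graphKernel N (d / N) (c₀ / (D N + 1)))
              fun y y' => ((symmDiff (S y) (S y')).card : ℝ) := by
  obtain ⟨dStar, hd1, hregime⟩ := eventually_regime hι
  refine ⟨dStar, hd1, fun d hd D hD π hπ c₀ hc₀ hc₁ => ?_⟩
  set K := ⌈8 / ι ^ 2⌉₊
  have hK : 0 < K := Nat.ceil_pos.2 (by positivity)
  obtain ⟨B, hB⟩ := exists_path_length hι hc₀ hc₁ hK
  have hlog0 : 0 < Real.log d := Real.log_pos (by linarith)
  have hd0 : 0 < d := by linarith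
  set c : ℝ := min (ι / 8) (1 / 4) * (Real.log d / d * Real.log d) with hc_def
  have hc : 0 < c := by positivity
  have hQ : 0 < π ^ 2 / 2 := by positivity
  set q := |Real.log (π ^ 2 / 2)|
  filter_upwards [hregime d hd, eventually_mul_add_one_le hD (q * B) (by positivity : 0 < c / 3),
    eventually_mul_add_one_le hD (B + 1) one_pos,
    eventually_mul_pow_lt_exp (K + 2) (K + 1) (by positivity : 0 < c / 3),
    eventually_gt_atTop 0] with N hregime hqB hBN hexp hN S hsuccess
  by_contra! hstable
  obtain ⟨W, m, hW0, hW, hm, hmB⟩ := hB (D N)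
  have hD1 : (1 : ℝ) ≤ D N + 1 := by simp
  have hε : c₀ / (D N + 1) ∈ Set.Icc (0 : ℝ) 1 :=
    ⟨by positivity, (div_le_one (by positivity)).2 (hc₁.trans hD1)⟩
  have hlower : Real.exp (-(c / 3 * N)) ≤ (π ^ 2 / 2) ^ 2 ^ m :=
    exp_neg_le_pow hQ <| (mul_le_mul_of_nonneg_left hmB (abs_nonneg _)).trans <| by
      linarith
  have hupper : ((K : ℝ) + 2) * ((2 ^ m : ℕ) + 1) ^ (K + 1) *
      Real.exp (-min (ι / 8) (1 / 4) * (Real.log d / d * N * Real.log d))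
      < Real.exp (c / 3 * N) * Real.exp (-(c * N)) := by
    rw [show -min (ι / 8) (1 / 4) * (Real.log d / d * N * Real.log d) = -(c * N) by
      rw [hc_def]; ring]
    refine mul_lt_mul_of_pos_right (lt_of_le_of_lt ?_ hexp) (Real.exp_pos _)
    gcongr
    linarith
  have hβ : 0 < ι / 4 * (Real.log d / d * N) := by positivity
  have hpath := (pow_le_pathProb_stableSuccess ⟨hregime.p_nonneg, hregime.p_le_one⟩ hε hβ hπ.le
    hsuccess hstable m).trans
    (hregime.pathProb_stableSuccess_le hε (by positivity) hW0 hm hW S)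
  have hcontra := (hlower.trans hpath).trans_lt hupper
  rw [← Real.exp_add, Real.exp_lt_exp] at hcontra
  linarith [mul_pos hc (Nat.cast_pos (α := ℝ).2 hN)]

end Asymptotics

section Law

variable {N : ℕ}

theorem edgeVector_bijective : Function.Bijective (edgeVector (N := N)) := by
  refine ⟨fun G H h => SimpleGraph.edgeSet_injective (Set.ext fun e => ?_), fun y =>
    ⟨SimpleGraph.fromEdgeSet {e | ∃ h : ¬e.IsDiag, y ⟨e, h⟩ = true}, funext fun ⟨e, he⟩ => ?_⟩⟩
  · by_cases he : e.IsDiag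
    · exact iff_of_false (fun h => SimpleGraph.not_isDiag_of_mem_edgeSet _ h he)
        fun h => SimpleGraph.not_isDiag_of_mem_edgeSet _ h he
    · simpa [edgeVector] using congrFun h ⟨e, he⟩
  · simp [edgeVector, he]

theorem card_edgeVector_eq_true (G : SimpleGraph (Fin N)) :
    {e | edgeVector G e = true}.ncard = G.edgeSet.ncard := by
  rw [← Set.ncard_image_of_injective _ Subtype.val_injective]
  congr 1
  ext e
  simp only [edgeVector, decide_eq_true_eq, Set.mem_image, Set.mem_ofPred_eq, Subtype.exists,
    exists_and_left, exists_prop, exists_eq_right_right, and_iff_left_iff_imp]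
  exact SimpleGraph.not_isDiag_of_mem_edgeSet G

theorem binomialRandom_singleton_eq_graphWeight (p : unitInterval) (G : SimpleGraph (Fin N)) :
    SimpleGraph.binomialRandom (Fin N) p {G} = ENNReal.ofReal (graphWeight N p (edgeVector G)) := by
  have hedges : Finset.card {e | edgeVector G e = true} = G.edgeSet.ncard := by
    rw [← card_edgeVector_eq_true, Set.ncard_eq_toFinset_card']
    simp
  have hnonedges : Finset.card {e | ¬edgeVector G e = true}
      = (Nat.card (Fin N)).choose 2 - G.edgeSet.ncard := by
    have hpairs : Fintype.card (VertexPair N) = (Fintype.card (Fin N)).choose 2 :=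
      Sym2.card_subtype_not_diag
    have hsplit := Finset.card_filter_add_card_filter_not (s := .univ)
      fun e => edgeVector G e = true
    rw [Finset.card_univ, hpairs, hedges] at hsplit
    rw [Nat.card_eq_fintype_card]
    lia
  have hp : ENNReal.ofReal p = unitInterval.toNNReal p := ENNReal.ofReal_eq_coe_nnreal p.2.1
  have hp' : ENNReal.ofReal (1 - p) = unitInterval.toNNReal (unitInterval.symm p) :=
    ENNReal.ofReal_eq_coe_nnreal (sub_nonneg.2 p.2.2)
  rw [SimpleGraph.binomialRandom_singleton, ← hp, ← hp', ← hnonedges, ← hedges]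
  simp only [graphWeight, piWeight, bernoulliWeight]
  rw [Finset.prod_ite, Finset.prod_const, Finset.prod_const,
    ENNReal.ofReal_mul (pow_nonneg p.2.1 _), ENNReal.ofReal_pow p.2.1,
    ENNReal.ofReal_pow (sub_nonneg.2 p.2.2)]

instance : MeasurableSingletonClass (SimpleGraph (Fin N)) where
  measurableSet_singleton G := by
    convert SimpleGraph.measurable_edgeSet (measurableSet_singleton G.edgeSet)
    ext H
    simp

theorem lintegral_binomialRandom (p : unitInterval) {F : (VertexPair N → Bool) → ℝ}
    (hF : 0 ≤ F) :
    ∫⁻ G, ENNReal.ofReal (F (edgeVector G)) ∂SimpleGraph.binomialRandom (Fin N) p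
      = ENNReal.ofReal (graphWeight N p ⬝ᵥ F) := by
  have hweight : 0 ≤ graphWeight N p :=
    (piWeight_mem_stdSimplex (bernoulliWeight_mem_stdSimplex p.2)).1
  classical
  rw [lintegral_fintype, dotProduct,
    ENNReal.ofReal_sum_of_nonneg fun y _ => mul_nonneg (hweight y) (hF y)]
  exact Fintype.sum_bijective edgeVector edgeVector_bijective _ _ fun G => by
    rw [binomialRandom_singleton_eq_graphWeight, mul_comm, ENNReal.ofReal_mul (hweight _)]

theorem binomialRandom_preimage_edgeVector (p : unitInterval) (T : Set (VertexPair N → Bool)) :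
    SimpleGraph.binomialRandom (Fin N) p (edgeVector ⁻¹' T)
      = ENNReal.ofReal (graphWeight N p ⬝ᵥ T.indicator 1) := by
  have hT : 0 ≤ T.indicator (1 : (VertexPair N → Bool) → ℝ) :=
    Set.indicator_nonneg fun _ _ => zero_le_one
  rw [← lintegral_binomialRandom p hT,
    ← lintegral_indicator_one (Set.toFinite _).measurableSet]
  refine lintegral_congr fun G => ?_
  by_cases hG : edgeVector G ∈ T <;> simp [hG]

theorem sparseGraph_eq_binomialRandom {d : ℝ} (hp : d / N ∈ unitInterval) :
    sparseGraph N d = SimpleGraph.binomialRandom (Fin N) ⟨d / N, hp⟩ := by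
  rw [sparseGraph, Set.projIcc_of_mem zero_le_one hp]

end Law

section Rounding

variable {N : ℕ}

/-- The vertex set encoded by the rounding of `x` at the thresholds `U`. -/
def rounded (U : Fin N → ℝ) (x : EuclideanSpace ℝ (Fin N)) : Finset (Fin N) := {i | U i ≤ x i}

theorem vertexSet_roundVector (U : Fin N → ℝ) (x : EuclideanSpace ℝ (Fin N)) :
    vertexSet (roundVector U x) = rounded U x := by
  ext i
  simp only [vertexSet, roundVector, round, rounded, Set.mem_ofPred_eq, Finset.coe_filter,
    Finset.mem_univ, true_and, ite_eq_left_iff, not_le]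
  norm_num

theorem isIndepSet_iff_edgeFree (G : SimpleGraph (Fin N)) (S : Finset (Fin N)) :
    G.IsIndepSet S ↔ EdgeFree S (edgeVector G) := by
  refine ⟨fun hS ⟨e, he⟩ heS => ?_, fun hS v hv w hw hvw hadj => ?_⟩
  · induction e with
    | _ v w =>
      rw [mem_inside] at heS
      simpa [edgeVector] using
        hS (heS v (Sym2.mem_mk_left v w)) (heS w (Sym2.mem_mk_right v w)) he
  · refine hS ⟨s(v, w), by simpa using hvw⟩ (mem_inside.2 fun u hu => ?_)
      (by simpa [edgeVector] using hadj)
    rcases Sym2.mem_iff.1 hu with rfl | rfl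
    exacts [hv, hw]

instance : IsProbabilityMeasure (ProbabilityTheory.cond volume (Set.Icc (-1 : ℝ) 1)) :=
  ProbabilityTheory.cond_isProbabilityMeasure_of_finite (by simp) (by simp)

instance : IsProbabilityMeasure (uniformNoise N) := by
  unfold uniformNoise
  infer_instance

theorem cond_symmDiff_Iic_le (x x' : ℝ) :
    ProbabilityTheory.cond volume (Set.Icc (-1 : ℝ) 1) (symmDiff (Set.Iic x) (Set.Iic x'))
      ≤ ENNReal.ofReal (|x - x'| / 2) := by
  have hsub : symmDiff (Set.Iic x) (Set.Iic x') ⊆ Set.uIcc x x' := by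
    rintro u (⟨hu, hu'⟩ | ⟨hu, hu'⟩)
    · exact Set.mem_uIcc_of_ge (not_le.1 hu').le hu
    · exact Set.mem_uIcc_of_le (not_le.1 hu').le hu
  have hvolume : volume (Set.Icc (-1 : ℝ) 1) = 2 := by
    rw [Real.volume_Icc]
    norm_num
  rw [ProbabilityTheory.cond_apply measurableSet_Icc, hvolume, abs_sub_comm,
    ENNReal.ofReal_div_of_pos two_pos, ENNReal.div_eq_inv_mul, ENNReal.ofReal_ofNat,
    ← Real.volume_interval]
  gcongr
  exact Set.inter_subset_right.trans hsub

theorem ofReal_card_symmDiff_rounded (U : Fin N → ℝ) (x x' : EuclideanSpace ℝ (Fin N)) :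
    ENNReal.ofReal (symmDiff (rounded U x) (rounded U x')).card
      = ∑ i, (symmDiff (Set.Iic (x i)) (Set.Iic (x' i))).indicator 1 (U i) := by
  classical
  have hfilter : symmDiff (rounded U x) (rounded U x')
      = Finset.univ.filter fun i => U i ∈ symmDiff (Set.Iic (x i)) (Set.Iic (x' i)) := by
    ext i
    simp [rounded, Finset.mem_symmDiff, Set.mem_symmDiff]
  rw [hfilter, ENNReal.ofReal_natCast, Finset.natCast_card_filter]
  simp [Set.indicator_apply]

theorem measurable_indicator_symmDiff_Iic (x x' : ℝ) :
    Measurable ((symmDiff (Set.Iic x) (Set.Iic x')).indicator (1 : ℝ → ENNReal)) :=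
  measurable_one.indicator (measurableSet_Iic.symmDiff measurableSet_Iic)

theorem measurable_rounded :
    Measurable fun z : (Fin N → ℝ) × EuclideanSpace ℝ (Fin N) => rounded z.1 z.2 := by
  refine measurable_finset_iff.2 fun i => ?_
  simp only [rounded, Finset.mem_filter, Finset.mem_univ, true_and]
  have hle : MeasurableSet {z : (Fin N → ℝ) × EuclideanSpace ℝ (Fin N) | z.1 i ≤ z.2 i} :=
    measurableSet_le (by fun_prop) (by fun_prop)
  exact hle.mem

theorem measurable_card_symmDiff_rounded (x x' : EuclideanSpace ℝ (Fin N)) :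
    Measurable fun U => ENNReal.ofReal (symmDiff (rounded U x) (rounded U x')).card := by
  have hrounded (x : EuclideanSpace ℝ (Fin N)) : Measurable fun U => rounded U x :=
    measurable_rounded.comp (measurable_id.prodMk measurable_const)
  have hcard : Measurable fun U => (symmDiff (rounded U x) (rounded U x')).card :=
    (measurable_of_finite fun S : Finset (Fin N) × Finset (Fin N) => (symmDiff S.1 S.2).card).comp
      ((hrounded x).prodMk (hrounded x'))
  fun_prop

theorem lintegral_card_symmDiff_rounded_le (x x' : EuclideanSpace ℝ (Fin N)) :
    ∫⁻ U, ENNReal.ofReal (symmDiff (rounded U x) (rounded U x')).card ∂uniformNoise N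
      ≤ ENNReal.ofReal (∑ i, |x i - x' i| / 2) := by
  have hmeas (i : Fin N) : Measurable fun U : Fin N → ℝ =>
      (symmDiff (Set.Iic (x i)) (Set.Iic (x' i))).indicator (1 : ℝ → ENNReal) (U i) :=
    (measurable_indicator_symmDiff_Iic _ _).comp (measurable_pi_apply i)
  simp only [ofReal_card_symmDiff_rounded]
  rw [lintegral_finsetSum _ fun i _ => hmeas i,
    ENNReal.ofReal_sum_of_nonneg fun i _ => by positivity]
  refine Finset.sum_le_sum fun i _ => le_trans (le_of_eq ?_) (cond_symmDiff_Iic_le (x i) (x' i))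
  rw [← lintegral_indicator_one (measurableSet_Iic.symmDiff measurableSet_Iic)]
  exact (measurePreserving_eval (fun _ : Fin N =>
    ProbabilityTheory.cond volume (Set.Icc (-1 : ℝ) 1)) i).lintegral_comp
      (measurable_indicator_symmDiff_Iic _ _)

end Rounding

section Displacement

variable {κ Γ ι : Type*} [Fintype κ] [DecidableEq κ] [Fintype Γ] [DecidableEq Γ] [Fintype ι]

theorem sum_abs_half_le {r : ℝ} (hr : 0 < r) (x : EuclideanSpace ℝ ι) :
    ∑ i, |x i| / 2 ≤ Fintype.card ι * r / 4 + 1 / (4 * r) * ‖x‖ ^ 2 := by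
  have habs (t : ℝ) : |t| / 2 ≤ r / 4 + 1 / (4 * r) * t ^ 2 := by
    have hsq : r / 4 + 1 / (4 * r) * t ^ 2 - |t| / 2 = (r - |t|) ^ 2 / (4 * r) := by
      rw [← sq_abs t]
      field_simp
      ring
    exact sub_nonneg.1 (hsq ▸ by positivity)
  refine (Finset.sum_le_sum fun i _ => habs (x i)).trans_eq ?_
  rw [Finset.sum_add_distrib, ← Finset.mul_sum, EuclideanSpace.real_norm_sq_eq, Finset.sum_const,
    Finset.card_univ, nsmul_eq_mul, mul_div_assoc]

variable {q : Γ → ℝ} {ε : ℝ} {D : ℕ} {f : (κ → Γ) → EuclideanSpace ℝ ι}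
  (hq : q ∈ stdSimplex ℝ Γ) (hε : ε ∈ Set.Icc (0 : ℝ) 1)
  (hf : ∀ i, (fun y => f y i) ∈ degreeFunctions κ Γ D)
include hq hε hf

theorem stepMean_norm_sub_sq_le :
    stepMean (piWeight q) (piKernel fun _ => resample q ε) (fun y z => ‖f y - f z‖ ^ 2)
      ≤ 2 * D * ε * (piWeight q ⬝ᵥ fun y => ‖f y‖ ^ 2) := by
  simp only [EuclideanSpace.real_norm_sq_eq, PiLp.sub_apply, stepMean_sum]
  refine (Finset.sum_le_sum fun i _ => stepMean_sub_sq_le hq hε (hf i)).trans_eq ?_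
  simp only [← Finset.mul_sum, dotProduct, Pi.mul_apply, ← sq]
  rw [Finset.sum_comm]
  simp only [Finset.mul_sum]

theorem stepMean_sum_abs_sub_le {r : ℝ} (hr : 0 < r) :
    stepMean (piWeight q) (piKernel fun _ => resample q ε) (fun y z => ∑ i, |f y i - f z i| / 2)
      ≤ Fintype.card ι * r / 4 + D * ε / (2 * r) * (piWeight q ⬝ᵥ fun y => ‖f y‖ ^ 2) := by
  have hμ := piWeight_mem_stdSimplex (κ := κ) hq
  have hR := piKernel_mem_rowStochastic (κ := κ) fun _ => resample_mem_rowStochastic hq hε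
  calc _ ≤ stepMean (piWeight q) (piKernel fun _ => resample q ε) fun y z =>
          Fintype.card ι * r / 4 + 1 / (4 * r) * ‖f y - f z‖ ^ 2 :=
        stepMean_mono hμ.1 hR.1 fun y z => sum_abs_half_le hr (f y - f z)
    _ ≤ Fintype.card ι * r / 4
          + 1 / (4 * r) * (2 * D * ε * (piWeight q ⬝ᵥ fun y => ‖f y‖ ^ 2)) := by
        rw [stepMean_const_add_mul hμ.2 hR]
        gcongr
        exact stepMean_norm_sub_sq_le hq hε hf
    _ = _ := by
        field_simp
        ring

end Displacement

section Markov

variable {Z : Type*} [MeasurableSpace Z] {ν : Measure Z}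

theorem lintegral_stepMean_le {V : Type*} [Fintype V] {μ : V → ℝ} {R : Matrix V V ℝ}
    (hμ : 0 ≤ μ) (hR : ∀ x y, 0 ≤ R x y) {F : V → V → Z → ℝ} {G : V → V → ℝ}
    (hF : ∀ x y z, 0 ≤ F x y z) (hG : ∀ x y, 0 ≤ G x y)
    (hmeas : ∀ x y, Measurable fun z => ENNReal.ofReal (F x y z))
    (hle : ∀ x y, ∫⁻ z, ENNReal.ofReal (F x y z) ∂ν ≤ ENNReal.ofReal (G x y)) :
    ∫⁻ z, ENNReal.ofReal (stepMean μ R fun x y => F x y z) ∂ν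
      ≤ ENNReal.ofReal (stepMean μ R G) := by
  have hw (x y : V) : 0 ≤ μ x * R x y := mul_nonneg (hμ x) (hR x y)
  have hexpand {H : V → V → ℝ} (hH : ∀ x y, 0 ≤ H x y) : ENNReal.ofReal (stepMean μ R H)
      = ∑ x, ∑ y, ENNReal.ofReal (μ x * R x y) * ENNReal.ofReal (H x y) := by
    rw [stepMean, ENNReal.ofReal_sum_of_nonneg fun x _ =>
      Finset.sum_nonneg fun y _ => mul_nonneg (hw x y) (hH x y)]
    refine Finset.sum_congr rfl fun x _ => ?_
    rw [ENNReal.ofReal_sum_of_nonneg fun y _ => mul_nonneg (hw x y) (hH x y)]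
    exact Finset.sum_congr rfl fun y _ => ENNReal.ofReal_mul (hw x y)
  simp only [hexpand (hF · · _), hexpand hG]
  rw [lintegral_finsetSum _ fun x _ => Finset.measurable_sum _ fun y _ => (hmeas x y).const_mul _]
  refine Finset.sum_le_sum fun x _ => ?_
  rw [lintegral_finsetSum _ fun y _ => (hmeas x y).const_mul _]
  refine Finset.sum_le_sum fun y _ => ?_
  rw [lintegral_const_mul _ (hmeas x y)]
  gcongr
  exact hle x y

theorem lintegral_le_add_lintegral_div [IsProbabilityMeasure ν] {s h : Z → ℝ} {π b : ℝ}
    (hs : ∀ z, s z ≤ 1) (hb : 0 < b) (hsh : ∀ z, π ≤ s z → b ≤ h z) :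
    ∫⁻ z, ENNReal.ofReal (s z) ∂ν
      ≤ ENNReal.ofReal π + (∫⁻ z, ENNReal.ofReal (h z) ∂ν) / ENNReal.ofReal b := by
  have hb' : ENNReal.ofReal b ≠ 0 := (ENNReal.ofReal_pos.2 hb).ne'
  have hpoint (z : Z) : ENNReal.ofReal (s z)
      ≤ ENNReal.ofReal π + ENNReal.ofReal (h z) / ENNReal.ofReal b := by
    rcases le_or_gt π (s z) with hz | hz
    · refine le_add_left ((ENNReal.ofReal_le_one.2 (hs z)).trans ?_)
      rw [ENNReal.le_div_iff_mul_le (.inl hb') (.inl ENNReal.ofReal_ne_top), one_mul]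
      exact ENNReal.ofReal_le_ofReal (hsh z hz)
    · exact le_add_right (ENNReal.ofReal_le_ofReal hz.le)
  refine (lintegral_mono hpoint).trans_eq ?_
  simp only [div_eq_mul_inv]
  rw [lintegral_add_left measurable_const, lintegral_const, measure_univ, mul_one,
    lintegral_mul_const' _ _ (ENNReal.inv_ne_top.2 hb')]

end Markov

section Derandomize

variable {N : ℕ} {Ω : Type*} [MeasurableSpace Ω] {P : Measure Ω} [IsProbabilityMeasure P]
  {A : (VertexPair N → Bool) → Ω → EuclideanSpace ℝ (Fin N)}
  (hA : Measurable (Function.uncurry A)) (p : unitInterval)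
include hA

theorem lintegral_enorm_sq_eq :
    ∫⁻ z, ‖A (edgeVector z.1) z.2‖ₑ ^ 2 ∂(SimpleGraph.binomialRandom (Fin N) p).prod P
      = ∫⁻ ω, ENNReal.ofReal (graphWeight N p ⬝ᵥ fun y => ‖A y ω‖ ^ 2) ∂P := by
  have hmeas : Measurable fun z : SimpleGraph (Fin N) × Ω => ‖A (edgeVector z.1) z.2‖ₑ ^ 2 :=
    (hA.comp (((measurable_of_finite edgeVector).comp measurable_fst).prodMk
      measurable_snd)).enorm.pow_const 2
  rw [lintegral_prod_symm _ hmeas.aemeasurable]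
  refine lintegral_congr fun ω => ?_
  rw [← lintegral_binomialRandom p fun y => sq_nonneg ‖A y ω‖]
  simp only [ENNReal.ofReal_pow (norm_nonneg _), ofReal_norm]

theorem measure_large_independent_eq (a : ℝ) :
    ((SimpleGraph.binomialRandom (Fin N) p).prod (P.prod (uniformNoise N)))
      {z | z.1.IsIndepSet (vertexSet (roundVector z.2.2 (A (edgeVector z.1) z.2.1))) ∧
        a ≤ ((vertexSet (roundVector z.2.2 (A (edgeVector z.1) z.2.1))).ncard : ℝ)}
      = ∫⁻ z, ENNReal.ofReal (graphWeight N p ⬝ᵥ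
          {y | Success a (fun y => rounded z.2 (A y z.1)) y}.indicator 1)
          ∂P.prod (uniformNoise N) := by
  have hrounded : Measurable fun z : SimpleGraph (Fin N) × (Ω × (Fin N → ℝ)) =>
      (edgeVector z.1, rounded z.2.2 (A (edgeVector z.1) z.2.1)) := by
    have hedge : Measurable fun z : SimpleGraph (Fin N) × (Ω × (Fin N → ℝ)) => edgeVector z.1 :=
      (measurable_of_finite edgeVector).comp measurable_fst
    exact hedge.prodMk (measurable_rounded.comp (measurable_snd.snd.prodMk
      (hA.comp (hedge.prodMk measurable_snd.fst))))
  simp only [vertexSet_roundVector, isIndepSet_iff_edgeFree, Set.ncard_coe_finset]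
  have hevent := hrounded (Set.toFinite
    {x : (VertexPair N → Bool) × Finset (Fin N) | EdgeFree x.2 x.1 ∧ a ≤ x.2.card}).measurableSet
  refine (Measure.prod_apply_symm hevent).trans ?_
  exact lintegral_congr fun z => binomialRandom_preimage_edgeVector p
    {y | Success a (fun y => rounded z.2 (A y z.1)) y}

variable {ε C r : ℝ} {D : ℕ} (hε : ε ∈ Set.Icc (0 : ℝ) 1) (hC : 0 ≤ C) (hr : 0 < r)
  (hdeg : ∀ ω i, (fun y => A y ω i) ∈ degreeFunctions (VertexPair N) Bool D)
  (hnorm : ∫⁻ z, ‖A (edgeVector z.1) z.2‖ₑ ^ 2 ∂(SimpleGraph.binomialRandom (Fin N) p).prod P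
    ≤ ENNReal.ofReal (C * N))
include hε hC hr hdeg hnorm

theorem lintegral_stepMean_card_symmDiff_le :
    ∫⁻ z, ENNReal.ofReal (stepMean (graphWeight N p) (graphKernel N p ε) fun y y' =>
        ((symmDiff (rounded z.2 (A y z.1)) (rounded z.2 (A y' z.1))).card : ℝ))
        ∂P.prod (uniformNoise N)
      ≤ ENNReal.ofReal (N * (r / 4 + D * ε / (2 * r) * C)) := by
  have hq := bernoulliWeight_mem_stdSimplex p.2
  have hμ := (piWeight_mem_stdSimplex (κ := VertexPair N) hq).1
  have hR := (piKernel_mem_rowStochastic (κ := VertexPair N)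
    fun _ => resample_mem_rowStochastic hq hε).1
  have hrε : 0 ≤ D * ε / (2 * r) := by have := hε.1; positivity
  have hfixed (ω : Ω) : ∫⁻ U, ENNReal.ofReal (stepMean (graphWeight N p) (graphKernel N p ε)
        fun y y' => ((symmDiff (rounded U (A y ω)) (rounded U (A y' ω))).card : ℝ)) ∂uniformNoise N
      ≤ ENNReal.ofReal (N * r / 4) + ENNReal.ofReal (D * ε / (2 * r))
        * ENNReal.ofReal (graphWeight N p ⬝ᵥ fun y => ‖A y ω‖ ^ 2) := by
    refine (lintegral_stepMean_le hμ hR (fun _ _ _ => Nat.cast_nonneg _)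
      (fun y y' => Finset.sum_nonneg fun i _ => by positivity)
      (fun y y' => measurable_card_symmDiff_rounded (A y ω) (A y' ω))
      fun y y' => lintegral_card_symmDiff_rounded_le (A y ω) (A y' ω)).trans ?_
    rw [← ENNReal.ofReal_mul hrε]
    refine (ENNReal.ofReal_le_ofReal ?_).trans ENNReal.ofReal_add_le
    simpa using stepMean_sum_abs_sub_le hq hε (hdeg ω) hr
  refine ((lintegral_prod_le _).trans (lintegral_mono hfixed)).trans ?_
  rw [lintegral_add_left measurable_const, lintegral_const, measure_univ, mul_one,
    lintegral_const_mul' _ _ ENNReal.ofReal_ne_top, ← lintegral_enorm_sq_eq hA p]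
  calc _ ≤ ENNReal.ofReal (N * r / 4)
          + ENNReal.ofReal (D * ε / (2 * r)) * ENNReal.ofReal (C * N) := by gcongr
    _ = _ := by
        rw [← ENNReal.ofReal_mul hrε, ← ENNReal.ofReal_add (by positivity) (by positivity)]
        congr 1
        ring

/-- Markov's inequality over the internal randomness `z`: each `z` for which the success probability
is at least `π` contributes a movement of at least `b` to a mean movement of at most `π * b`. -/
theorem measure_large_independent_le {a π b : ℝ} (hb : 0 < b)
    (hmove : ∀ S, π ≤ graphWeight N p ⬝ᵥ {y | Success a S y}.indicator 1 →
      b < stepMean (graphWeight N p) (graphKernel N p ε) fun y y' =>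
        ((symmDiff (S y) (S y')).card : ℝ))
    (hbudget : N * (r / 4 + D * ε / (2 * r) * C) ≤ π * b) :
    ((SimpleGraph.binomialRandom (Fin N) p).prod (P.prod (uniformNoise N)))
      {z | z.1.IsIndepSet (vertexSet (roundVector z.2.2 (A (edgeVector z.1) z.2.1))) ∧
        a ≤ ((vertexSet (roundVector z.2.2 (A (edgeVector z.1) z.2.1))).ncard : ℝ)}
      ≤ ENNReal.ofReal (2 * π) := by
  have hμ := piWeight_mem_stdSimplex (κ := VertexPair N) (bernoulliWeight_mem_stdSimplex p.2)
  have hsuccess (S : (VertexPair N → Bool) → Finset (Fin N)) :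
      graphWeight N p ⬝ᵥ {y | Success a S y}.indicator 1 ≤ 1 := by
    refine (dotProduct_le_dotProduct_of_nonneg_left
      (Set.indicator_le_self' fun _ _ => zero_le_one) hμ.1).trans_eq ?_
    exact (dotProduct_one _).trans hμ.2
  have hmoved := (lintegral_stepMean_card_symmDiff_le hA p hε hC hr hdeg hnorm).trans
    (ENNReal.ofReal_le_ofReal hbudget)
  have hπ : 0 ≤ π := by
    refine nonneg_of_mul_nonneg_left (hbudget.trans' ?_) hb
    have := hε.1
    positivity
  rw [measure_large_independent_eq hA p]
  calc _ ≤ ENNReal.ofReal π + ENNReal.ofReal (π * b) / ENNReal.ofReal b :=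
        (lintegral_le_add_lintegral_div (fun z => hsuccess _) hb
          fun z hz => (hmove _ hz).le).trans (by gcongr)
    _ = ENNReal.ofReal (2 * π) := by
        rw [← ENNReal.ofReal_div_of_pos hb, mul_div_cancel_right₀ _ hb.ne',
          ← ENNReal.ofReal_add hπ hπ, two_mul]

end Derandomize

theorem exists_budget {C δ : ℝ} (hC : 0 ≤ C) (hδ : 0 < δ) :
    ∃ r : ℝ, 0 < r ∧ ∃ c₀ : ℝ, 0 < c₀ ∧ c₀ ≤ 1 ∧
      ∀ D : ℕ, c₀ / (D + 1) ∈ Set.Icc (0 : ℝ) 1 ∧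
        r / 4 + D * (c₀ / (D + 1)) / (2 * r) * C ≤ δ := by
  refine ⟨2 * δ, by positivity, min 1 (2 * δ ^ 2 / (C + 1)), by positivity, min_le_left _ _,
    fun D => ?_⟩
  set c₀ := min 1 (2 * δ ^ 2 / (C + 1))
  have hc₀ : 0 ≤ c₀ := by positivity
  have hε : c₀ / (D + 1) ≤ 1 :=
    div_le_one_of_le₀ (by linarith [min_le_left 1 (2 * δ ^ 2 / (C + 1)), D.cast_nonneg (α := ℝ)])
      (by positivity)
  refine ⟨⟨by positivity, hε⟩, ?_⟩
  have hCc₀ : c₀ * C ≤ 2 * δ ^ 2 :=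
    calc c₀ * C ≤ c₀ * (C + 1) := by gcongr; linarith
      _ ≤ 2 * δ ^ 2 := (le_div_iff₀ (by positivity)).1 (min_le_right _ _)
  have hD : D * (c₀ / (D + 1)) ≤ c₀ := by
    rw [mul_div_assoc', div_le_iff₀ (by positivity)]
    linarith
  calc _ ≤ 2 * δ / 4 + c₀ / (2 * (2 * δ)) * C := by gcongr
    _ = 2 * δ / 4 + c₀ * C / (2 * (2 * δ)) := by ring
    _ ≤ 2 * δ / 4 + 2 * δ ^ 2 / (2 * (2 * δ)) := by gcongr
    _ = δ := by
        field_simp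
        ring

end SparseIndep

end

theorem corollary3p10 (ι : ℝ) (hι : 0 < ι) :
    ∃ dStar : ℝ, ∀ d : ℝ, dStar ≤ d →
      ∀ (C : ℝ) (D : ℕ → ℕ),
        (fun N : ℕ => (D N : ℝ)) =o[atTop] (fun N : ℕ => (N : ℝ)) →
      ∀ (Ω : ℕ → Type*) [∀ N, MeasurableSpace (Ω N)]
        (P : ∀ N, Measure (Ω N)) [∀ N, IsProbabilityMeasure (P N)]
        (A : ∀ N, (SparseIndep.VertexPair N → Bool) → Ω N → EuclideanSpace ℝ (Fin N)),
        (∀ N, Measurable (Function.uncurry (A N))) →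
        (∀ N (ω : Ω N) (i : Fin N), (fun y => A N y ω i) ∈
          SparseIndep.degreeFunctions (SparseIndep.VertexPair N) Bool (D N)) →
        (∀ᶠ N : ℕ in atTop,
          ∫⁻ z : SimpleGraph (Fin N) × Ω N, ‖A N (SparseIndep.edgeVector z.1) z.2‖ₑ ^ 2
            ∂((SparseIndep.sparseGraph N d).prod (P N)) ≤ ENNReal.ofReal (C * N)) →
        Tendsto
          (fun N : ℕ =>
            ((SparseIndep.sparseGraph N d).prod ((P N).prod (SparseIndep.uniformNoise N)))
              {z : SimpleGraph (Fin N) × (Ω N × (Fin N → ℝ)) |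
                z.1.IsIndepSet (SparseIndep.vertexSet (SparseIndep.roundVector z.2.2
                  (A N (SparseIndep.edgeVector z.1) z.2.1))) ∧
                (1 + ι) * Real.log d / d * N ≤
                  ((SparseIndep.vertexSet (SparseIndep.roundVector z.2.2
                    (A N (SparseIndep.edgeVector z.1) z.2.1))).ncard : ℝ)})
          atTop (𝓝 0) := by
  obtain ⟨dStar, hdStar, hmove⟩ := SparseIndep.eventually_lt_stepMean hι
  refine ⟨dStar, fun d hd C D hD Ω _ P _ A hA hdeg hnorm =>
    ENNReal.tendsto_nhds_zero.2 fun δ hδ => ?_⟩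
  obtain ⟨η, hη, hηδ⟩ := ENNReal.lt_iff_exists_nnreal_btwn.1 hδ
  have hd0 : 0 < d := one_pos.trans (hdStar.trans_le hd)
  have hlog : 0 < Real.log d := Real.log_pos (hdStar.trans_le hd)
  have hπ : 0 < (η / 2 : ℝ) := half_pos (mod_cast hη)
  have hrate : 0 < (η / 2 : ℝ) ^ 2 / 2 * (ι / 4 * (Real.log d / d)) := by positivity
  obtain ⟨r, hr, c₀, hc₀, hc₀1, hbudget⟩ :=
    SparseIndep.exists_budget (le_max_right C 0) (mul_pos hπ hrate)
  filter_upwards [hmove d hd D hD _ hπ c₀ hc₀ hc₀1, hnorm,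
    tendsto_natCast_atTop_atTop.eventually_ge_atTop d] with N hmove hnorm hdN
  have hN : (0 : ℝ) < N := hd0.trans_le hdN
  have hp : d / N ∈ unitInterval := ⟨by positivity, (div_le_one hN).2 hdN⟩
  rw [SparseIndep.sparseGraph_eq_binomialRandom hp] at hnorm ⊢
  rw [show (1 + ι) * Real.log d / d * N = (1 + ι) * (Real.log d / d * N) by ring]
  have hnorm' := hnorm.trans (ENNReal.ofReal_le_ofReal
    (mul_le_mul_of_nonneg_right (le_max_left C 0) hN.le))
  refine (SparseIndep.measure_large_independent_le (hA N) ⟨d / N, hp⟩ (hbudget (D N)).1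
    (le_max_right C 0) hr (hdeg N) hnorm' (by positivity) hmove ?_).trans ?_
  · linarith [mul_le_mul_of_nonneg_left (hbudget (D N)).2 hN.le]
  · rw [mul_div_cancel₀ _ two_ne_zero, ENNReal.ofReal_coe_nnreal]
    exact hηδ.le
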